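/- Let $n\ge 1$, let $(M,\omega)$ be an $n$-plectic manifold (that is, $M$ is a smooth manifold and $\omega\in\Omega^{n+1}(M)$ is closed with $T_aM\to\Lambda^nT_a^*M$, $u\mapsto\iota_u\omega_a$, injective for every $a\in M$), and let $H\in\Omega^{n-1}(M)$ be a Hamiltonian form with Hamiltonian vector field $v_H$, i.e. $dH=-\iota_{v_H}\omega$. Let $\mathfrak g$ be a real Lie algebra and $\mathfrak g\to\mathfrak X(M)$, $x\mapsto v_x$, a Lie algebra homomorphism with $\mathcal L_{v_x}\omega=0$ and $\mathcal L_{v_x}H=0$ for all $x\in\mathfrak g$ (a strictly $H$-preserving infinitesimal action). Notation: $\varsigma(k)=-(-1)^{k(k+1)/2}$; $\iota(v_p)=\iota_{v_{x_k}}\cdots\iota_{v_{x_1}}$ for $p=x_1\wedge\dots\wedge x_k$, extended linearly to $p\in\Lambda^k\mathfrak g$; $\partial(x_1\wedge\dots\wedge x_k)=\sum_{i<j}(-1)^{i+j}[x_i,x_j]\wedge x_1\wedge\dots\wedge\hat x_i\wedge\dots\wedge\hat x_j\wedge\dots\wedge x_k$ is the Lie algebra homology differential (with $\partial=0$ on $\Lambda^0\mathfrak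 g$ and $\Lambda^1\mathfrak g$), and $Z_k(\mathfrak g)=\ker\partial|_{\Lambda^k\mathfrak g}$. A co-momentum map for an action $v$ with $\mathcal L_{v_x}\omega=0$ is a family of linear maps $f_k:\Lambda^k\mathfrak g\to\Omega^{n-k}(M)$, $1\le k\le n$, with $d f_1(x)=-\iota_{v_x}\omega$ for all $x\in\mathfrak g$ (in particular each $f_1(x)$ is a Hamiltonian form) and $$-f_{k-1}(\partial p)=d f_k(p)+\varsigma(k)\,\iota(v_p)\omega\qquad\text{for }1\le k\le n+1,\ p\in\Lambda^k\mathfrak g,$$ where $f_0=f_{n+1}=0$. A form $\alpha$ is globally conserved by a vector field $u$ if $\mathcal L_u\alpha$ is exact (for $\alpha\in\Omega^0(M)$: if $\mathcal L_u\alpha=0$). Let $(f)$ be a co-momentum map for $x\mapsto v_x$. Then: 1. On the direct sum Lie algebra $\tilde{\mathfrak g}=\mathfrak g\oplus\mathbb R c$, the map extending $x\mapsto v_x$ by $c\mapsto v_H$ is a Lie algebra homomorphism $\tilde{\mathfrak g}\to\mathfrak X(M)$ whose values preserve $\omega$. 2. There is exactly one co-momentum map $(\tilde f)$ for this $\tilde{\mathfrak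 g}$-action that restricts to $(f)$ on $\Lambda^\bullet\mathfrak g$ and satisfies, for $1\le k\le n$ and $p\in\Lambda^{k-1}\mathfrak g$, writing $p\otimes c:=p\wedge c\in\Lambda^k\tilde{\mathfrak g}$, $$\tilde f_k(p\otimes c)=\varsigma(k)\,\iota(v_p)H .$$ 3. For all $1\le k\le n$ and all $p\in Z_{k-1}(\mathfrak g)$, the form $\tilde f_k(p\otimes c)$ is globally conserved by $v_H$. (It is not assumed that $\mathcal L_{v_H}H=0$.) -/

import Mathlib

open scoped Manifold ContDiff

noncomputable section

namespace Multisymplectic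

/-! ## Multilinear algebra -/

section Algebra

variable {V : Type*} [AddCommGroup V] [Module ℝ V] [TopologicalSpace V]

/-- Interior product of an alternating form with one vector:
`(ι_X a)(w₁, …, w_j) = a(X, w₁, …, w_j)`. -/
def interior {j : ℕ} (X : V) (a : V [⋀^Fin (j + 1)]→L[ℝ] ℝ) : V [⋀^Fin j]→L[ℝ] ℝ where
  toFun w := a (Fin.cons X w)
  map_update_add' w i y z := by
    have := (a.toAlternatingMap.curryLeft X).map_update_add' w i y z
    exact this
  map_update_smul' w i c y := by
    have := (a.toAlternatingMap.curryLeft X).map_update_smul' w i c y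
    exact this
  cont := by
    refine a.cont.comp (continuous_pi fun i => ?_)
    refine Fin.cases ?_ (fun i => ?_) i
    · simpa using continuous_const
    · simpa using continuous_apply i
  map_eq_zero_of_eq' w i i' h hne :=
    (a.toAlternatingMap.curryLeft X).map_eq_zero_of_eq' w i i' h hne

theorem append_update {k j : ℕ} {α : Type*} [DecidableEq (Fin k)] (X : Fin k → α)
    (w : Fin j → α) (i : Fin k) (y : α) :
    Fin.append (Function.update X i y) w
      = Function.update (Fin.append X w) (Fin.castAdd j i) y := by
  funext a
  refine Fin.addCases (fun a => ?_) (fun a => ?_) a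
  · by_cases h : a = i
    · subst h; simp
    · have : Fin.castAdd j a ≠ Fin.castAdd j i := fun e => h (Fin.castAdd_injective _ _ e)
      simp [h]
  · have : Fin.natAdd k a ≠ Fin.castAdd j i := by
      intro e; have := congrArg Fin.val e; simp at this; omega
    simp [this]

theorem append_update_right {k j : ℕ} {α : Type*} [DecidableEq (Fin j)] (X : Fin k → α)
    (w : Fin j → α) (i : Fin j) (y : α) :
    Fin.append X (Function.update w i y)
      = Function.update (Fin.append X w) (Fin.natAdd k i) y := by
  funext a
  refine Fin.addCases (fun a => ?_) (fun a => ?_) a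
  · have : Fin.castAdd j a ≠ Fin.natAdd k i := by
      intro e; have := congrArg Fin.val e; simp at this; omega
    simp [this]
  · by_cases h : a = i
    · subst h; simp
    · have : Fin.natAdd k a ≠ Fin.natAdd k i := fun e => h (Fin.natAdd_injective _ _ e)
      simp [h]

/-- Contraction with `k` vectors: `ι(X₁ ∧ … ∧ X_k) a = ι_{X_k} ⋯ ι_{X_1} a`, that is,
`(w₁, …, w_j) ↦ a(X₁, …, X_k, w₁, …, w_j)`. -/
def contractVectors {k j N : ℕ} (h : k + j = N) (a : V [⋀^Fin N]→L[ℝ] ℝ) (X : Fin k → V) :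
    V [⋀^Fin j]→L[ℝ] ℝ where
  toFun w := a (fun i => Fin.append X w (Fin.cast h.symm i))
  map_update_add' w i y z := by
    subst h
    have := a.map_update_add' (Fin.append X w) (Fin.natAdd k i) y z
    simp only [← append_update_right] at this
    exact this
  map_update_smul' w i c y := by
    subst h
    have := a.map_update_smul' (Fin.append X w) (Fin.natAdd k i) c y
    simp only [← append_update_right] at this
    exact this
  cont := by
    subst h
    refine a.cont.comp (continuous_pi fun i => ?_)
    refine Fin.addCases (fun i => ?_) (fun i => ?_) i
    · simpa using continuous_const
    · simpa using continuous_apply i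
  map_eq_zero_of_eq' w i i' hw hne := by
    subst h
    refine a.map_eq_zero_of_eq' _ (Fin.natAdd k i) (Fin.natAdd k i') (by simpa using hw) ?_
    exact fun e => hne (Fin.natAdd_injective _ _ e)

/-- `contractVectors` as an alternating function of the `k` vectors. -/
def contractAlt {k j N : ℕ} (h : k + j = N) (a : V [⋀^Fin N]→L[ℝ] ℝ) :
    V [⋀^Fin k]→ₗ[ℝ] (V [⋀^Fin j]→L[ℝ] ℝ) where
  toFun X := contractVectors h a X
  map_update_add' X i y z := by
    subst h
    ext w
    have := a.map_update_add' (Fin.append X w) (Fin.castAdd j i) y z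
    simp only [← append_update] at this
    exact this
  map_update_smul' X i c y := by
    subst h
    ext w
    have := a.map_update_smul' (Fin.append X w) (Fin.castAdd j i) c y
    simp only [← append_update] at this
    exact this
  map_eq_zero_of_eq' X i i' hX hne := by
    subst h
    ext w
    refine a.map_eq_zero_of_eq' _ (Fin.castAdd j i) (Fin.castAdd j i') (by simpa using hX) ?_
    exact fun e => hne (Fin.castAdd_injective _ _ e)

/-- Contraction `ι(P) a` of an alternating form with a multivector `P ∈ Λᵏ V`: the linear
extension of `contractVectors`. -/
def contract {k j N : ℕ} (h : k + j = N) (P : ⋀[ℝ]^k V) (a : V [⋀^Fin N]→L[ℝ] ℝ) :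
    V [⋀^Fin j]→L[ℝ] ℝ :=
  exteriorPower.alternatingMapLinearEquiv (contractAlt h a) P

end Algebra

/-- The product `p ∧ c ∈ Λ^{k+1} V` of `p ∈ Λᵏ V` with a vector `c`. -/
def wedgeVector {V : Type*} [AddCommGroup V] [Module ℝ V] {k : ℕ} (p : ⋀[ℝ]^k V) (c : V) :
    ⋀[ℝ]^(k + 1) V :=
  ⟨(p : ExteriorAlgebra ℝ V) * ExteriorAlgebra.ι ℝ c, by
    change _ ∈ LinearMap.range (ExteriorAlgebra.ι ℝ : V →ₗ[ℝ] _) ^ (k + 1)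
    rw [pow_succ]
    exact Submodule.mul_mem_mul p.2 ⟨c, rfl⟩⟩

/-- The sign `ς(k) = -(-1)^{k(k+1)/2}`. -/
def sgn (k : ℕ) : ℝ := -(-1) ^ (k * (k + 1) / 2)

/-! ## Lie algebra homology -/

section LieHomology

variable {𝔤 : Type*} [LieRing 𝔤] [LieAlgebra ℝ 𝔤]

open ExteriorAlgebra in
/-- Auxiliary: the derivation of `Λ 𝔤` extending `ad y`. -/
def adExt (y : 𝔤) : ExteriorAlgebra ℝ 𝔤 →ₗ[ℝ] ExteriorAlgebra ℝ 𝔤 :=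
  CliffordAlgebra.foldr' (0 : QuadraticForm ℝ 𝔤)
    (LinearMap.mk₂ ℝ (fun x (qs : ExteriorAlgebra ℝ 𝔤 × ExteriorAlgebra ℝ 𝔤) =>
        ι ℝ ⁅y, x⁆ * qs.1 + ι ℝ x * qs.2)
      (by intros; simp [add_mul]; abel) (by intros; simp)
      (by intros; simp [mul_add]; abel) (by intros; simp))
    (by
      intro x q s
      change ι ℝ ⁅y, x⁆ * (ι ℝ x * q) + ι ℝ x * (ι ℝ ⁅y, x⁆ * q + ι ℝ x * s) = _
      rw [mul_add, ← mul_assoc, ← mul_assoc, ← mul_assoc, ι_sq_zero, zero_mul, add_zero,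
        ← add_mul, ι_add_mul_swap]
      simp)
    0

open ExteriorAlgebra in
theorem adExt_ι_mul (y x : 𝔤) (q : ExteriorAlgebra ℝ 𝔤) :
    adExt y (ι ℝ x * q) = ι ℝ ⁅y, x⁆ * q + ι ℝ x * adExt y q :=
  CliffordAlgebra.foldr'_ι_mul _ _ _ _ _ _

theorem adExt_algebraMap (y : 𝔤) (r : ℝ) :
    adExt y (algebraMap ℝ (ExteriorAlgebra ℝ 𝔤) r) = 0 := by
  unfold adExt
  exact (CliffordAlgebra.foldr'_algebraMap _ _ _ _ r).trans (smul_zero r)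

theorem adExt_add (y z : 𝔤) (q : ExteriorAlgebra ℝ 𝔤) :
    adExt (y + z) q = adExt y q + adExt z q := by
  induction q using CliffordAlgebra.left_induction with
  | algebraMap r =>
    have h (w : 𝔤) := adExt_algebraMap w r
    exact (h _).trans (by rw [show (0 : ExteriorAlgebra ℝ 𝔤) = 0 + 0 by simp]; congr 1 <;> exact (h _).symm)
  | add a b ha hb => rw [map_add, map_add, map_add, ha, hb]; abel
  | ι_mul x m hx =>
    have h (w : 𝔤) := adExt_ι_mul w m x
    refine (h _).trans ?_
    rw [show adExt y _ = _ from h y, show adExt z _ = _ from h z, hx, add_lie, map_add]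
    noncomm_ring

theorem adExt_smul (c : ℝ) (y : 𝔤) (q : ExteriorAlgebra ℝ 𝔤) :
    adExt (c • y) q = c • adExt y q := by
  induction q using CliffordAlgebra.left_induction with
  | algebraMap r =>
    have h (w : 𝔤) := adExt_algebraMap w r
    exact (h _).trans (by rw [show adExt y _ = _ from h y, smul_zero])
  | add a b ha hb => rw [map_add, map_add, ha, hb, smul_add]
  | ι_mul x m hx =>
    have h (w : 𝔤) := adExt_ι_mul w m x
    refine (h _).trans ?_
    rw [show adExt y _ = _ from h y, hx, smul_lie, map_smul]
    simp

open ExteriorAlgebra in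
/-- Auxiliary: the homology differential on the whole exterior algebra, given by
`∂(x ∧ q) = -x ∧ ∂q - ad_x q`. -/
def boundaryExt : ExteriorAlgebra ℝ 𝔤 →ₗ[ℝ] ExteriorAlgebra ℝ 𝔤 :=
  CliffordAlgebra.foldr' (0 : QuadraticForm ℝ 𝔤)
    (LinearMap.mk₂ ℝ (fun x (qs : ExteriorAlgebra ℝ 𝔤 × ExteriorAlgebra ℝ 𝔤) =>
        -(ι ℝ x * qs.2) - adExt x qs.1)
      (by intros; simp [add_mul, adExt_add]; abel)
      (by intros; simp [adExt_smul, smul_sub])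
      (by intros; simp [mul_add]; abel) (by intros; simp [smul_sub]))
    (by
      intro x q s
      change -(ι ℝ x * (-(ι ℝ x * s) - adExt x q)) - adExt x (ι ℝ x * q) = _
      rw [adExt_ι_mul, mul_sub, mul_neg, ← mul_assoc, ι_sq_zero]
      simp)
    0

open ExteriorAlgebra in
theorem boundaryExt_ι_mul (x : 𝔤) (q : ExteriorAlgebra ℝ 𝔤) :
    boundaryExt (ι ℝ x * q) = -(ι ℝ x * boundaryExt q) - adExt x q :=
  CliffordAlgebra.foldr'_ι_mul _ _ _ _ _ _

theorem boundaryExt_one : boundaryExt (1 : ExteriorAlgebra ℝ 𝔤) = 0 := by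
  rw [← map_one (algebraMap ℝ (ExteriorAlgebra ℝ 𝔤))]
  unfold boundaryExt
  exact (CliffordAlgebra.foldr'_algebraMap _ _ _ _ 1).trans (smul_zero _)

theorem adExt_one (y : 𝔤) : adExt y (1 : ExteriorAlgebra ℝ 𝔤) = 0 := by
  simpa using adExt_algebraMap y 1

theorem adExt_ιMulti (y : 𝔤) {k : ℕ} (x : Fin (k + 1) → 𝔤) :
    adExt y (ExteriorAlgebra.ιMulti ℝ (k + 1) x) =
      ∑ j : Fin (k + 1), (-1 : ℝ) ^ (j : ℕ) •
        (ExteriorAlgebra.ι ℝ ⁅y, x j⁆ * ExteriorAlgebra.ιMulti ℝ k (fun l => x (j.succAbove l))) := by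
  induction k with
  | zero =>
    rw [ExteriorAlgebra.ιMulti_succ_apply, adExt_ι_mul]
    simp [adExt_one]
  | succ k ih =>
    rw [ExteriorAlgebra.ιMulti_succ_apply, adExt_ι_mul, ih]
    refine Eq.trans ?_ (Fin.sum_univ_succ _).symm
    congr 1
    · simp [Matrix.vecTail, Function.comp_def]
    · rw [Finset.mul_sum]
      refine Finset.sum_congr rfl fun j _ => ?_
      rw [ExteriorAlgebra.ιMulti_succ_apply (v := fun l => x (j.succ.succAbove l))]
      simp only [Matrix.vecTail, Function.comp_def, Fin.succ_succAbove_zero,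
        Fin.succ_succAbove_succ, Fin.val_succ, pow_succ, mul_smul_comm, ← mul_assoc]
      rw [eq_neg_of_add_eq_zero_left (ExteriorAlgebra.ι_add_mul_swap (x 0) ⁅y, x j.succ⁆)]
      simp

theorem boundaryExt_ιMulti {k : ℕ} (x : Fin (k + 2) → 𝔤) :
    boundaryExt (ExteriorAlgebra.ιMulti ℝ (k + 2) x) =
      ∑ i : Fin (k + 2), ∑ j : Fin (k + 1), if i ≤ j.castSucc then
        (-1 : ℝ) ^ ((i : ℕ) + j + 1) • ExteriorAlgebra.ιMulti ℝ (k + 1)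
          (Fin.cons ⁅x i, x j.succ⁆ fun l => x (i.succAbove (j.succAbove l)))
        else 0 := by
  have hc (k : ℕ) (y : 𝔤) (z : Fin k → 𝔤) : ExteriorAlgebra.ιMulti ℝ (k + 1) (Fin.cons y z) =
      ExteriorAlgebra.ι ℝ y * ExteriorAlgebra.ιMulti ℝ k z := by
    rw [ExteriorAlgebra.ιMulti_succ_apply]; rfl
  simp only [hc]
  induction k with
  | zero =>
    rw [ExteriorAlgebra.ιMulti_succ_apply, boundaryExt_ι_mul, adExt_ιMulti,
      ExteriorAlgebra.ιMulti_succ_apply, boundaryExt_ι_mul]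
    simp [boundaryExt_one, adExt_one, Matrix.vecTail]
  | succ k ih =>
    rw [ExteriorAlgebra.ιMulti_succ_apply, boundaryExt_ι_mul, adExt_ιMulti, ih,
      sub_eq_add_neg, add_comm]
    refine Eq.trans ?_ (Fin.sum_univ_succ _).symm
    congr 1
    · rw [← Finset.sum_neg_distrib]
      refine Finset.sum_congr rfl fun j _ => ?_
      simp [Matrix.vecTail, Function.comp_def, pow_succ]
    · rw [Finset.mul_sum, ← Finset.sum_neg_distrib]
      refine Finset.sum_congr rfl fun i _ => ?_
      refine Eq.trans ?_ (Fin.sum_univ_succ _).symm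
      rw [if_neg (by simp), zero_add, Finset.mul_sum,
        ← Finset.sum_neg_distrib]
      refine Finset.sum_congr rfl fun j _ => ?_
      rw [← Fin.succ_castSucc]
      simp only [Fin.succ_le_succ_iff]
      split_ifs
      · rw [ExteriorAlgebra.ιMulti_succ_apply
          (v := fun l => x (i.succ.succAbove (j.succ.succAbove l)))]
        simp only [Matrix.vecTail, Function.comp_def, Fin.succ_succAbove_zero,
          Fin.succ_succAbove_succ, Fin.val_succ, mul_smul_comm, ← mul_assoc]
        rw [eq_neg_of_add_eq_zero_left
          (ExteriorAlgebra.ι_add_mul_swap (x 0) ⁅x i.succ, x j.succ.succ⁆)]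
        have e : (-1 : ℝ) ^ ((i : ℕ) + 1 + (j + 1) + 1) = (-1) ^ ((i : ℕ) + j + 1) := by ring
        rw [e]
        simp
      · simp

/-- The Lie algebra homology differential on decomposable elements, with indices from zero:
`∂(x₀ ∧ … ∧ x_{k+1}) = ∑_{i < j'} (-1)^{i+j'} [x_i, x_{j'}] ∧ x₀ ∧ … x̂_i … x̂_{j'} … ∧ x_{k+1}`,
where `j' = j + 1`. -/
def boundaryFun (k : ℕ) (x : Fin (k + 2) → 𝔤) : ⋀[ℝ]^(k + 1) 𝔤 :=
  ∑ i : Fin (k + 2), ∑ j : Fin (k + 1), if i ≤ j.castSucc then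
    (-1 : ℝ) ^ ((i : ℕ) + j + 1) • exteriorPower.ιMulti ℝ (k + 1)
      (Fin.cons ⁅x i, x j.succ⁆ fun l => x (i.succAbove (j.succAbove l)))
    else 0

theorem coe_boundaryFun {k : ℕ} (x : Fin (k + 2) → 𝔤) :
    (boundaryFun k x : ExteriorAlgebra ℝ 𝔤) =
      boundaryExt (ExteriorAlgebra.ιMulti ℝ (k + 2) x) := by
  rw [boundaryExt_ιMulti]
  simp only [boundaryFun, AddSubmonoidClass.coe_finsetSum]
  refine Finset.sum_congr rfl fun i _ => Finset.sum_congr rfl fun j _ => ?_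
  split_ifs <;> simp

/-- `boundaryFun` as an alternating map. -/
def boundaryAlt (k : ℕ) : 𝔤 [⋀^Fin (k + 2)]→ₗ[ℝ] ⋀[ℝ]^(k + 1) 𝔤 where
  toFun := boundaryFun k
  map_update_add' := by intros; apply Subtype.ext; simp [coe_boundaryFun]
  map_update_smul' := by intros; apply Subtype.ext; simp [coe_boundaryFun]
  map_eq_zero_of_eq' := by
    intro x i j h hne
    apply Subtype.ext
    rw [coe_boundaryFun, AlternatingMap.map_eq_zero_of_eq _ x h hne]
    simp

/-- The Lie algebra homology differential `∂ : Λ^{k+1} 𝔤 → Λᵏ 𝔤`. -/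
def boundary : ∀ k : ℕ, ⋀[ℝ]^(k + 1) 𝔤 →ₗ[ℝ] ⋀[ℝ]^k 𝔤
  | 0 => 0
  | k + 1 => exteriorPower.alternatingMapLinearEquiv (boundaryAlt k)

variable (𝔤) in
/-- `Z_k(𝔤)`: the cycles of degree `k` (`∂` vanishes on `Λ⁰ 𝔤`). -/
def cycles : ∀ k : ℕ, Submodule ℝ (⋀[ℝ]^k 𝔤)
  | 0 => ⊤
  | k + 1 => LinearMap.ker (boundary k)

end LieHomology

/-! ## Differential forms on a manifold -/

section Forms

variable {E : Type*} [NormedAddCommGroup E] [NormedSpace ℝ E]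
  {M : Type*} [TopologicalSpace M] [ChartedSpace E M]

variable (E M) in
/-- Fields of alternating `k`-forms on the tangent spaces of `M`, with no regularity. -/
abbrev RawForm (k : ℕ) : Type _ :=
  ∀ x : M, (TangentSpace 𝓘(ℝ, E) x) [⋀^Fin k]→L[ℝ] ℝ

/-- The expression of a form in the chart around `x₀`: its pullback under the inverse chart. -/
def chartRep {k : ℕ} (x₀ : M) (α : RawForm E M k) : E → E [⋀^Fin k]→L[ℝ] ℝ := fun y =>
  (α ((extChartAt 𝓘(ℝ, E) x₀).symm y)).compContinuousLinearMap
    (mfderiv 𝓘(ℝ, E) 𝓘(ℝ, E) (extChartAt 𝓘(ℝ, E) x₀).symm y)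

variable (E M) in
/-- The space of smooth `k`-forms, i.e. those whose expression in every chart is `C^∞`. -/
def Form (k : ℕ) : Submodule ℝ (RawForm E M k) where
  carrier := {α | ∀ x₀ : M, ContDiffOn ℝ ∞ (chartRep x₀ α) (extChartAt 𝓘(ℝ, E) x₀).target}
  add_mem' ha hb x₀ := (ha x₀).add (hb x₀)
  zero_mem' _ := contDiffOn_const (c := (0 : E [⋀^Fin k]→L[ℝ] ℝ))
  smul_mem' c _ ha x₀ := (ha x₀).const_smul c

/-- The exterior derivative: at `x`, it is Mathlib's exterior derivative of the expression of the
form in the chart around `x`, pulled back to `T_x M` by the chart. -/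
def extD {k : ℕ} (α : RawForm E M k) : RawForm E M (k + 1) := fun x =>
  (extDeriv (chartRep x α) (extChartAt 𝓘(ℝ, E) x x)).compContinuousLinearMap
    (mfderiv 𝓘(ℝ, E) 𝓘(ℝ, E) (extChartAt 𝓘(ℝ, E) x) x)

variable [IsManifold 𝓘(ℝ, E) ∞ M]

variable (E M) in
/-- `𝔛(M)`: the smooth vector fields on `M`. -/
abbrev VField : Type _ := ContMDiffSection 𝓘(ℝ, E) E ∞ (TangentSpace 𝓘(ℝ, E) : M → Type _)

variable (E) in
/-- The value of a vector field at a point, as a linear map. -/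
def evalAt (x : M) : VField E M →ₗ[ℝ] TangentSpace 𝓘(ℝ, E) x where
  toFun X := X x
  map_add' _ _ := rfl
  map_smul' _ _ := rfl

/-- The interior product `ι_X α`. -/
def iota {k : ℕ} (X : VField E M) (α : RawForm E M (k + 1)) : RawForm E M k := fun x =>
  interior (X x) (α x)

/-- The Lie derivative `L_X = d ι_X + ι_X d` (on functions `L_X = ι_X d`). -/
def lieD : ∀ {k : ℕ}, VField E M → RawForm E M k → RawForm E M k
  | 0, X, α => iota X (extD α)
  | _ + 1, X, α => extD (iota X α) + iota X (extD α)

/-- A form is exact if it is `d` of a smooth form; there are no nonzero forms of degree `-1`. -/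
def IsExact : ∀ {k : ℕ}, RawForm E M k → Prop
  | 0, α => α = 0
  | k + 1, α => ∃ γ ∈ Form E M k, extD γ = α

/-- `α` is globally conserved by `X`: the Lie derivative `L_X α` is exact. -/
def GloballyConserved {k : ℕ} (X : VField E M) (α : RawForm E M k) : Prop :=
  IsExact (lieD X α)

/-- `Ω` is an `n`-plectic form: a closed, nondegenerate form of degree `n + 1`. -/
structure IsPlectic {n : ℕ} (Ω : Form E M (n + 1)) : Prop where
  closed : extD (Ω : RawForm E M (n + 1)) = 0
  nondegenerate : ∀ x : M, Function.Injective
    fun X : TangentSpace 𝓘(ℝ, E) x => interior X ((Ω : RawForm E M (n + 1)) x)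

/-- `X` is a Hamiltonian vector field of the `(n-1)`-form `α`, where `n = m + 1`:
`dα = -ι_X Ω`. -/
def IsHamiltonianVF {m : ℕ} (Ω : Form E M (m + 2)) (α : Form E M m) (X : VField E M) : Prop :=
  extD (α : RawForm E M m) = -iota X (Ω : RawForm E M (m + 2))

/-- `α` is a Hamiltonian form. -/
def IsHamiltonianForm {m : ℕ} (Ω : Form E M (m + 2)) (α : Form E M m) : Prop :=
  ∃ X : VField E M, IsHamiltonianVF Ω α X

end Forms

/-! ## Infinitesimal actions and homotopy co-momentum maps -/

section Actions

variable {E : Type*} [NormedAddCommGroup E] [NormedSpace ℝ E]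
  {M : Type*} [TopologicalSpace M] [ChartedSpace E M] [IsManifold 𝓘(ℝ, E) ∞ M]
  {𝔤 : Type*} [LieRing 𝔤] [LieAlgebra ℝ 𝔤]

/-- `v : 𝔤 → 𝔛(M)` is a multisymplectic infinitesimal action: a homomorphism of Lie algebras
with `L_{v_x} Ω = 0` for all `x`. -/
structure IsMultisymplecticAction {N : ℕ} (Ω : Form E M N) (v : 𝔤 →ₗ[ℝ] VField E M) : Prop where
  map_lie : ∀ (x y : 𝔤) (a : M),
    v ⁅x, y⁆ a = VectorField.mlieBracket 𝓘(ℝ, E) (v x) (v y) a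
  preserves : ∀ x : 𝔤, lieD (v x) (Ω : RawForm E M N) = 0

/-- The action is strictly `H`-preserving: `L_{v_x} H = 0` for all `x`. -/
def StrictlyPreserves {k : ℕ} (v : 𝔤 →ₗ[ℝ] VField E M) (H : Form E M k) : Prop :=
  ∀ x : 𝔤, lieD (v x) (H : RawForm E M k) = 0

/-- `ι(v_p) α`, where `v_p = v_{x₁} ∧ … ∧ v_{x_k}` for `p = x₁ ∧ … ∧ x_k`, extended linearly
to all `p ∈ Λᵏ 𝔤`. -/
def iotaP {k j N : ℕ} (h : k + j = N) (v : 𝔤 →ₗ[ℝ] VField E M) (p : ⋀[ℝ]^k 𝔤)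
    (α : RawForm E M N) : RawForm E M j := fun a =>
  contract h (exteriorPower.map k (evalAt E a ∘ₗ v) p) (α a)

/-- A (homotopy) co-momentum map `(f)` of the infinitesimal action `v` on `(M, Ω)`, where `Ω` has
degree `n + 1` and `n = m + 1`: linear maps `f_i : Λⁱ 𝔤 → Ω^{n-i}(M)`, with `f_0 = f_{n+1} = 0`,
such that `f_1` takes values in Hamiltonian forms, `d f_1(x) = -ι_{v_x} Ω`, and
`-f_{k-1}(∂p) = d f_k(p) + ς(k) ι(v_p) Ω` for `1 ≤ k ≤ n + 1` and `p ∈ Λᵏ 𝔤`.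
The form degree `j = n - i` is carried as a separate index. -/
@[ext]
structure CoMomentum {m : ℕ} (Ω : Form E M (m + 2)) (v : 𝔤 →ₗ[ℝ] VField E M) where
  f : ∀ i j : ℕ, i + j = m + 1 → (⋀[ℝ]^i 𝔤 →ₗ[ℝ] Form E M j)
  f_zero : f 0 (m + 1) (Nat.zero_add _) = 0
  hamiltonian : ∀ p : ⋀[ℝ]^1 𝔤, IsHamiltonianForm Ω (f 1 m (Nat.add_comm 1 m) p)
  momentum : ∀ x : 𝔤,
    IsHamiltonianVF Ω (f 1 m (Nat.add_comm 1 m) (exteriorPower.ιMulti ℝ 1 ![x])) (v x)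
  /-- The equation for `k = i + 1 ≤ n`. -/
  main : ∀ (i j : ℕ) (h : i + (j + 1) = m + 1) (p : ⋀[ℝ]^(i + 1) 𝔤),
    -(f i (j + 1) h (boundary i p) : RawForm E M (j + 1)) =
      extD (f (i + 1) j (by omega) p : RawForm E M j)
        + sgn (i + 1) • iotaP (by omega) v p (Ω : RawForm E M (m + 2))
  /-- The equation for `k = n + 1`. -/
  main_top : ∀ p : ⋀[ℝ]^(m + 2) 𝔤,
    -(f (m + 1) 0 rfl (boundary (m + 1) p) : RawForm E M 0) =
      sgn (m + 2) • iotaP rfl v p (Ω : RawForm E M (m + 2))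

/-- `ℝ` as the abelian one-dimensional Lie algebra. -/
instance instLieRingReal : LieRing ℝ where
  bracket _ _ := 0
  add_lie _ _ _ := (add_zero 0).symm
  lie_add _ _ _ := (add_zero 0).symm
  lie_self _ := rfl
  leibniz_lie _ _ _ := (add_zero 0).symm

instance instLieAlgebraReal : LieAlgebra ℝ ℝ where
  lie_smul c _ _ := (smul_zero c).symm

/-- The extension of an action of `𝔤` to `𝔤 ⊕ ℝc` (the product Lie algebra `𝔤 × ℝ`, with
`c = (0, 1)`), by `c ↦ X`. -/
def extendAction (v : 𝔤 →ₗ[ℝ] VField E M) (X : VField E M) : 𝔤 × ℝ →ₗ[ℝ] VField E M :=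
  v.coprod (LinearMap.toSpanSingleton ℝ (VField E M) X)

/-- `p ⊗ c ∈ Λ^{k+1}(𝔤 ⊕ ℝc)` for `p ∈ Λᵏ 𝔤`. -/
def tensorC {k : ℕ} (p : ⋀[ℝ]^k 𝔤) : ⋀[ℝ]^(k + 1) (𝔤 × ℝ) :=
  wedgeVector (exteriorPower.map k (LinearMap.inl ℝ 𝔤 ℝ) p) ((0 : 𝔤), (1 : ℝ))

/-- `F` restricts to `f` on `Λ 𝔤`, and `F_k(p ⊗ c) = ς(k) ι(v_p) H` for `1 ≤ k ≤ n = m + 1` and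
`p ∈ Λ^{k-1} 𝔤`. -/
structure IsExtension {m : ℕ} {Ω : Form E M (m + 2)} {v : 𝔤 →ₗ[ℝ] VField E M} {X : VField E M}
    (f : CoMomentum Ω v) (H : Form E M m) (F : CoMomentum (𝔤 := 𝔤 × ℝ) Ω (extendAction v X)) : Prop where
  restrict : ∀ (i j : ℕ) (h : i + j = m + 1) (p : ⋀[ℝ]^i 𝔤),
    F.f i j h (exteriorPower.map i (LinearMap.inl ℝ 𝔤 ℝ) p) = f.f i j h p
  apply_tensorC : ∀ (i j : ℕ) (h : i + j = m) (p : ⋀[ℝ]^i 𝔤),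
    (F.f (i + 1) j (by omega) (tensorC p) : RawForm E M j) =
      sgn (i + 1) • iotaP h v p (H : RawForm E M m)

end Actions

end Multisymplectic

end

noncomputable section

namespace Multisymplectic

section Flat

variable {E : Type*} [NormedAddCommGroup E] [NormedSpace ℝ E]

theorem interior_eq_curryLeft {j : ℕ} (X : E) (a : E [⋀^Fin (j + 1)]→L[ℝ] ℝ) :
    interior X a = a.curryLeft X := rfl

theorem interior_apply {j : ℕ} (X : E) (a : E [⋀^Fin (j + 1)]→L[ℝ] ℝ) (w : Fin j → E) :
    interior X a w = a (Fin.cons X w) := rfl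

/-- The bounded bilinear interior product. -/
def interiorL (j : ℕ) :
    (E [⋀^Fin (j + 1)]→L[ℝ] ℝ) →L[ℝ] E →L[ℝ] E [⋀^Fin j]→L[ℝ] ℝ :=
  (ContinuousAlternatingMap.curryLeftLI (𝕜 := ℝ) (E := E) (F := ℝ) (n := j)).toContinuousLinearMap

/-- The Lie derivative of a form on a vector space, by Cartan's formula. -/
def lieFlat : ∀ {k : ℕ}, (E → E) → (E → E [⋀^Fin k]→L[ℝ] ℝ) → E → E [⋀^Fin k]→L[ℝ] ℝ
  | 0, X, α => fun x => interior (X x) (extDeriv α x)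
  | _ + 1, X, α => fun x =>
      extDeriv (fun y => interior (X y) (α y)) x + interior (X x) (extDeriv α x)

theorem lieFlat_congr {k : ℕ} {X : E → E} {α β : E → E [⋀^Fin k]→L[ℝ] ℝ} {x : E}
    (h : α =ᶠ[nhds x] β) : lieFlat X α x = lieFlat X β x := by
  cases k with
  | zero => simp only [lieFlat, h.extDeriv_eq]
  | succ k =>
    have h' : (fun y => interior (X y) (α y)) =ᶠ[nhds x] fun y => interior (X y) (β y) :=
      h.mono fun y hy => by simp only [hy]
    simp only [lieFlat, h.extDeriv_eq, h'.extDeriv_eq]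

theorem hasFDerivAt_interior {k : ℕ} {X : E → E} {α : E → E [⋀^Fin (k + 1)]→L[ℝ] ℝ} {x : E}
    (hX : DifferentiableAt ℝ X x) (hα : DifferentiableAt ℝ α x) :
    HasFDerivAt (fun y => interior (X y) (α y))
      ((interiorL k).precompR E (α x) (fderiv ℝ X x) +
        (interiorL k).precompL E (fderiv ℝ α x) (X x)) x :=
  (interiorL k).hasFDerivAt_of_bilinear hα.hasFDerivAt hX.hasFDerivAt

theorem fderiv_interior_apply {k : ℕ} {X : E → E} {α : E → E [⋀^Fin (k + 1)]→L[ℝ] ℝ} {x : E}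
    (hX : DifferentiableAt ℝ X x) (hα : DifferentiableAt ℝ α x) (u : E) (w : Fin k → E) :
    fderiv ℝ (fun y => interior (X y) (α y)) x u w =
      α x (Fin.cons (fderiv ℝ X x u) w) + fderiv ℝ α x u (Fin.cons (X x) w) := by
  rw [(hasFDerivAt_interior hX hα).fderiv]
  rfl

theorem interior_extDeriv_apply {k : ℕ} {α : E → E [⋀^Fin k]→L[ℝ] ℝ} {x : E}
    (hα : DifferentiableAt ℝ α x) (u : E) (w : Fin k → E) :
    interior u (extDeriv α x) w = fderiv ℝ α x u w -
      ∑ i : Fin k, (-1 : ℝ) ^ (i : ℕ) *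
        fderiv ℝ α x (w i) (i.succ.removeNth (Fin.cons u w : Fin (k + 1) → E)) := by
  rw [interior_apply, extDeriv_apply hα, Fin.sum_univ_succ, sub_eq_add_neg,
    ← Finset.sum_neg_distrib]
  simp [pow_succ, fderiv_continuousAlternatingMap_apply_const_apply hα]

theorem lieFlat_apply {k : ℕ} {X : E → E} {α : E → E [⋀^Fin k]→L[ℝ] ℝ} {x : E}
    (hX : DifferentiableAt ℝ X x) (hα : DifferentiableAt ℝ α x) (w : Fin k → E) :
    lieFlat X α x w = fderiv ℝ α x (X x) w +
      ∑ i : Fin k, α x (Function.update w i (fderiv ℝ X x (w i))) := by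
  cases k with
  | zero => simp [lieFlat, interior_extDeriv_apply hα]
  | succ k =>
    rw [lieFlat, ContinuousAlternatingMap.add_apply, interior_extDeriv_apply hα,
      extDeriv_apply (hasFDerivAt_interior hX hα).differentiableAt]
    simp only [fderiv_continuousAlternatingMap_apply_const_apply
      (hasFDerivAt_interior hX hα).differentiableAt, fderiv_interior_apply hX hα]
    have h (i : Fin (k + 1)) : i.succ.removeNth (Fin.cons (X x) w : Fin (k + 2) → E) =
        Fin.cons (X x) (i.removeNth w) := by
      funext l
      refine Fin.cases ?_ (fun l => ?_) l <;> simp [Fin.removeNth]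
    have h' (i : Fin (k + 1)) (y : E) : α x (Function.update w i y) =
        (-1 : ℝ) ^ (i : ℕ) * α x (Fin.cons y (i.removeNth w)) := by
      rw [← Fin.insertNth_removeNth, ContinuousAlternatingMap.map_insertNth]
      simp [Matrix.vecCons]
    simp only [h, h', smul_add, Finset.sum_add_distrib, zsmul_eq_mul]
    push_cast
    ring

/-- `[L_X, ι_Y] = ι_{[X, Y]}` on a vector space. -/
theorem lieFlat_interior {k : ℕ} {X Y : E → E} {α : E → E [⋀^Fin (k + 1)]→L[ℝ] ℝ} {x : E}
    (hX : DifferentiableAt ℝ X x) (hY : DifferentiableAt ℝ Y x) (hα : DifferentiableAt ℝ α x) :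
    lieFlat X (fun y => interior (Y y) (α y)) x =
      interior (Y x) (lieFlat X α x) + interior (VectorField.lieBracket ℝ X Y x) (α x) := by
  ext w
  rw [lieFlat_apply hX (hasFDerivAt_interior hY hα).differentiableAt,
    ContinuousAlternatingMap.add_apply, interior_apply, interior_apply, lieFlat_apply hX hα,
    fderiv_interior_apply hY hα, Fin.sum_univ_succ, VectorField.lieBracket]
  have h (a b : E) : α x (Fin.cons (a - b) w) = α x (Fin.cons a w) - α x (Fin.cons b w) := by
    simp only [← interior_apply, interior_eq_curryLeft, map_sub, ContinuousAlternatingMap.sub_apply]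
  simp only [h, Fin.cons_zero, Fin.cons_succ, Fin.update_cons_zero, ← Fin.cons_update,
    interior_apply]
  ring

theorem contDiffOn_interior {k : ℕ} {X : E → E} {α : E → E [⋀^Fin (k + 1)]→L[ℝ] ℝ} {s : Set E}
    (hX : ContDiffOn ℝ ∞ X s) (hα : ContDiffOn ℝ ∞ α s) :
    ContDiffOn ℝ ∞ (fun y => interior (X y) (α y)) s :=
  (interiorL (E := E) k).isBoundedBilinearMap.contDiff.comp_contDiffOn (hα.prodMk hX)

theorem contDiffOn_extDeriv {k : ℕ} {α : E → E [⋀^Fin k]→L[ℝ] ℝ} {s : Set E} (hs : IsOpen s)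
    (hα : ContDiffOn ℝ ∞ α s) : ContDiffOn ℝ ∞ (extDeriv α) s :=
  (ContinuousAlternatingMap.alternatizeUncurryFinCLM ℝ E ℝ).contDiff.comp_contDiffOn
    (hα.fderiv_of_isOpen hs (by simp))

end Flat

section Charts

variable {E : Type*} [NormedAddCommGroup E] [NormedSpace ℝ E]
  {M : Type*} [TopologicalSpace M] [ChartedSpace E M] [IsManifold 𝓘(ℝ, E) ∞ M]

theorem two_le_infty : minSmoothness ℝ 2 ≤ (∞ : WithTop ℕ∞) := by
  rw [minSmoothness_of_isRCLikeNormedField]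
  exact WithTop.coe_le_coe.2 (le_top : (2 : ℕ∞) ≤ ⊤)

variable (E) in
/-- The derivative of the chart around `x₀`, as a map of the model space. -/
def chartD (x₀ x : M) : E →L[ℝ] E := mfderiv 𝓘(ℝ, E) 𝓘(ℝ, E) (extChartAt 𝓘(ℝ, E) x₀) x

/-- The derivative of the inverse chart around `x₀`, as a map of the model space. -/
def chartSymmD (x₀ : M) (y : E) : E →L[ℝ] E :=
  mfderiv 𝓘(ℝ, E) 𝓘(ℝ, E) (extChartAt 𝓘(ℝ, E) x₀).symm y

theorem isManifold_one : IsManifold 𝓘(ℝ, E) 1 M :=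
  IsManifold.of_le (n := ∞) (by simp)

theorem chartD_comp_chartSymmD {x₀ : M} {y : E} (hy : y ∈ (extChartAt 𝓘(ℝ, E) x₀).target) :
    (chartD E x₀ ((extChartAt 𝓘(ℝ, E) x₀).symm y)).comp (chartSymmD x₀ y) =
      ContinuousLinearMap.id ℝ E := by
  have : IsManifold 𝓘(ℝ, E) 1 M := isManifold_one
  have h := mfderiv_extChartAt_comp_mfderivWithin_extChartAt_symm (I := 𝓘(ℝ, E)) hy
  rw [ModelWithCorners.range_eq_univ, mfderivWithin_univ] at h
  exact h

theorem chartSymmD_comp_chartD {x₀ : M} {y : E} (hy : y ∈ (extChartAt 𝓘(ℝ, E) x₀).target) :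
    (chartSymmD x₀ y).comp (chartD E x₀ ((extChartAt 𝓘(ℝ, E) x₀).symm y)) =
      ContinuousLinearMap.id ℝ E := by
  have : IsManifold 𝓘(ℝ, E) 1 M := isManifold_one
  have h := mfderivWithin_extChartAt_symm_comp_mfderiv_extChartAt (I := 𝓘(ℝ, E)) hy
  rw [ModelWithCorners.range_eq_univ, mfderivWithin_univ] at h
  exact h

omit [IsManifold 𝓘(ℝ, E) ∞ M] in
theorem isOpen_target (x₀ : M) : IsOpen (extChartAt 𝓘(ℝ, E) x₀).target :=
  isOpen_extChartAt_target x₀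

/-- A form, with all tangent spaces identified with the model space. -/
def formAt {k : ℕ} (α : RawForm E M k) (x : M) : E [⋀^Fin k]→L[ℝ] ℝ := α x

/-- A vector field, with all tangent spaces identified with the model space. -/
def fieldAt (X : VField E M) (x : M) : E := X x

/-- The expression of a vector field in the chart around `x₀`. -/
def fieldRep (x₀ : M) (X : VField E M) (y : E) : E :=
  chartD E x₀ ((extChartAt 𝓘(ℝ, E) x₀).symm y) (fieldAt X ((extChartAt 𝓘(ℝ, E) x₀).symm y))

omit [IsManifold 𝓘(ℝ, E) ∞ M] in
theorem chartRep_eq {k : ℕ} (x₀ : M) (α : RawForm E M k) (y : E) :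
    chartRep x₀ α y =
      (formAt α ((extChartAt 𝓘(ℝ, E) x₀).symm y)).compContinuousLinearMap (chartSymmD x₀ y) := rfl

omit [IsManifold 𝓘(ℝ, E) ∞ M] in
theorem formAt_extD {k : ℕ} (x : M) (α : RawForm E M k) :
    formAt (extD α) x = (extDeriv (chartRep x α)
      (extChartAt 𝓘(ℝ, E) x x)).compContinuousLinearMap (chartD E x x) := rfl

theorem formAt_iota {k : ℕ} (x : M) (X : VField E M) (α : RawForm E M (k + 1)) :
    formAt (iota X α) x = interior (fieldAt X x) (formAt α x) := rfl

theorem interior_compContinuousLinearMap {k : ℕ} (A : E →L[ℝ] E) (X : E)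
    (a : E [⋀^Fin (k + 1)]→L[ℝ] ℝ) :
    interior X (a.compContinuousLinearMap A) =
      (interior (A X) a).compContinuousLinearMap A := by
  ext w
  simp only [interior_apply, ContinuousAlternatingMap.compContinuousLinearMap_apply]
  congr 1
  funext i
  refine Fin.cases ?_ (fun i => ?_) i <;> simp

theorem chartRep_iota {k : ℕ} {x₀ : M} (X : VField E M) (α : RawForm E M (k + 1)) {y : E}
    (hy : y ∈ (extChartAt 𝓘(ℝ, E) x₀).target) :
    chartRep x₀ (iota X α) y = interior (fieldRep x₀ X y) (chartRep x₀ α y) := by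
  rw [chartRep_eq, chartRep_eq, formAt_iota, interior_compContinuousLinearMap]
  congr 2
  exact (DFunLike.congr_fun (chartSymmD_comp_chartD hy) _).symm

/-- The transition map from the chart around `x₀` to the chart around `z`. -/
def transition (x₀ z : M) : E → E := extChartAt 𝓘(ℝ, E) z ∘ (extChartAt 𝓘(ℝ, E) x₀).symm

theorem hasFDerivAt_transition {x₀ z : M} {y : E} (hy : y ∈ (extChartAt 𝓘(ℝ, E) x₀).target)
    (hz : (extChartAt 𝓘(ℝ, E) x₀).symm y ∈ (extChartAt 𝓘(ℝ, E) z).source) :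
    HasFDerivAt (transition x₀ z)
      ((chartD E z ((extChartAt 𝓘(ℝ, E) x₀).symm y)).comp (chartSymmD x₀ y)) y := by
  have : IsManifold 𝓘(ℝ, E) 1 M := isManifold_one
  have h₁ : MDifferentiableAt 𝓘(ℝ, E) 𝓘(ℝ, E) (extChartAt 𝓘(ℝ, E) x₀).symm y := by
    have := mdifferentiableWithinAt_extChartAt_symm (I := 𝓘(ℝ, E)) hy
    rwa [ModelWithCorners.range_eq_univ, mdifferentiableWithinAt_univ] at this
  have h₂ : MDifferentiableAt 𝓘(ℝ, E) 𝓘(ℝ, E) (extChartAt 𝓘(ℝ, E) z)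
      ((extChartAt 𝓘(ℝ, E) x₀).symm y) :=
    mdifferentiableAt_extChartAt (by rwa [← extChartAt_source 𝓘(ℝ, E)])
  exact (h₂.hasMFDerivAt.comp y h₁.hasMFDerivAt).hasFDerivAt

theorem contDiffAt_transition {x₀ z : M} {y : E} (hy : y ∈ (extChartAt 𝓘(ℝ, E) x₀).target)
    (hz : (extChartAt 𝓘(ℝ, E) x₀).symm y ∈ (extChartAt 𝓘(ℝ, E) z).source) :
    ContDiffAt ℝ ∞ (transition x₀ z) y := by
  have h₁ : ContMDiffAt 𝓘(ℝ, E) 𝓘(ℝ, E) ∞ (extChartAt 𝓘(ℝ, E) x₀).symm y :=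
    (contMDiffOn_extChartAt_symm x₀).contMDiffAt ((isOpen_target x₀).mem_nhds hy)
  have h₂ : ContMDiffAt 𝓘(ℝ, E) 𝓘(ℝ, E) ∞ (extChartAt 𝓘(ℝ, E) z)
      ((extChartAt 𝓘(ℝ, E) x₀).symm y) :=
    contMDiffAt_extChartAt' (by rwa [← extChartAt_source 𝓘(ℝ, E)])
  exact (h₂.comp y h₁).contDiffAt

/-- Expressions in two charts are related by pullback under the transition map. -/
theorem chartRep_eq_pullback {k : ℕ} {x₀ z : M} (α : RawForm E M k) {y : E}
    (hy : y ∈ (extChartAt 𝓘(ℝ, E) x₀).target)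
    (hz : (extChartAt 𝓘(ℝ, E) x₀).symm y ∈ (extChartAt 𝓘(ℝ, E) z).source) :
    chartRep x₀ α y = (chartRep z α (transition x₀ z y)).compContinuousLinearMap
      (fderiv ℝ (transition x₀ z) y) := by
  rw [(hasFDerivAt_transition hy hz).fderiv, chartRep_eq, chartRep_eq]
  have hinv : (extChartAt 𝓘(ℝ, E) z).symm (transition x₀ z y) =
      (extChartAt 𝓘(ℝ, E) x₀).symm y := (extChartAt 𝓘(ℝ, E) z).left_inv hz
  have h := chartSymmD_comp_chartD (E := E) (x₀ := z) (y := transition x₀ z y)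
    ((extChartAt 𝓘(ℝ, E) z).map_source hz)
  rw [hinv] at h ⊢
  ext w
  simp only [ContinuousAlternatingMap.compContinuousLinearMap_apply]
  congr 1
  funext i
  exact (DFunLike.congr_fun h (chartSymmD x₀ y (w i))).symm

omit [IsManifold 𝓘(ℝ, E) ∞ M] in
theorem Form.contDiffAt_chartRep {k : ℕ} {α : RawForm E M k} (hα : α ∈ Form E M k) {x₀ : M} {y : E}
    (hy : y ∈ (extChartAt 𝓘(ℝ, E) x₀).target) : ContDiffAt ℝ ∞ (chartRep x₀ α) y :=
  (hα x₀).contDiffAt ((isOpen_target x₀).mem_nhds hy)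

omit [IsManifold 𝓘(ℝ, E) ∞ M] in
theorem Form.differentiableAt_chartRep {k : ℕ} {α : RawForm E M k} (hα : α ∈ Form E M k) {x₀ : M}
    {y : E} (hy : y ∈ (extChartAt 𝓘(ℝ, E) x₀).target) : DifferentiableAt ℝ (chartRep x₀ α) y :=
  (Form.contDiffAt_chartRep hα hy).differentiableAt (by simp)

/-- The exterior derivative may be computed in any chart. -/
theorem chartRep_extD {k : ℕ} {α : RawForm E M k} (hα : α ∈ Form E M k) {x₀ : M} {y : E}
    (hy : y ∈ (extChartAt 𝓘(ℝ, E) x₀).target) :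
    chartRep x₀ (extD α) y = extDeriv (chartRep x₀ α) y := by
  set z := (extChartAt 𝓘(ℝ, E) x₀).symm y with hzdef
  have hz : (extChartAt 𝓘(ℝ, E) x₀).symm y ∈ (extChartAt 𝓘(ℝ, E) z).source :=
    mem_extChartAt_source z
  have hev : chartRep x₀ α =ᶠ[nhds y] fun y' =>
      (chartRep z α (transition x₀ z y')).compContinuousLinearMap
        (fderiv ℝ (transition x₀ z) y') := by
    have h₁ := (isOpen_target x₀).mem_nhds hy
    have h₂ : (extChartAt 𝓘(ℝ, E) x₀).symm ⁻¹' (extChartAt 𝓘(ℝ, E) z).source ∈ nhds y :=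
      (continuousAt_extChartAt_symm'' hy).preimage_mem_nhds
        ((isOpen_extChartAt_source z).mem_nhds hz)
    filter_upwards [h₁, h₂] with y' hy' hz'
    exact chartRep_eq_pullback α hy' hz'
  have hmem : transition x₀ z y ∈ (extChartAt 𝓘(ℝ, E) z).target := mem_extChartAt_target z
  rw [hev.extDeriv_eq, extDeriv_pullback (Form.differentiableAt_chartRep hα hmem)
    (contDiffAt_transition hy hz) two_le_infty, (hasFDerivAt_transition hy hz).fderiv,
    chartRep_eq, ← hzdef, formAt_extD]
  rfl

theorem extD_mem {k : ℕ} {α : RawForm E M k} (hα : α ∈ Form E M k) :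
    extD α ∈ Form E M (k + 1) := fun x₀ =>
  (contDiffOn_extDeriv (isOpen_target x₀) (hα x₀)).congr fun _ hy => chartRep_extD hα hy

/-- A form is determined by its expressions at the centres of the charts. -/
theorem RawForm.ext_chartRep {k : ℕ} {α β : RawForm E M k}
    (h : ∀ x : M, chartRep x α (extChartAt 𝓘(ℝ, E) x x) = chartRep x β (extChartAt 𝓘(ℝ, E) x x)) :
    α = β := by
  have key (γ : RawForm E M k) (x : M) : formAt γ x =
      (chartRep x γ (extChartAt 𝓘(ℝ, E) x x)).compContinuousLinearMap (chartD E x x) := by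
    have h := chartSymmD_comp_chartD (E := E) (mem_extChartAt_target (I := 𝓘(ℝ, E)) x)
    rw [chartRep_eq]
    rw [extChartAt_to_inv] at h ⊢
    ext w
    simp only [ContinuousAlternatingMap.compContinuousLinearMap_apply]
    congr 1
    funext i
    exact (DFunLike.congr_fun h (w i)).symm
  funext x
  change formAt α x = formAt β x
  rw [key, key, h]

omit [IsManifold 𝓘(ℝ, E) ∞ M] in
theorem chartRep_add {k : ℕ} (x₀ : M) (α β : RawForm E M k) :
    chartRep x₀ (α + β) = chartRep x₀ α + chartRep x₀ β := rfl

omit [IsManifold 𝓘(ℝ, E) ∞ M] in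
theorem chartRep_smul {k : ℕ} (x₀ : M) (c : ℝ) (α : RawForm E M k) :
    chartRep x₀ (c • α) = c • chartRep x₀ α := rfl

theorem extD_add {k : ℕ} {α β : RawForm E M k} (hα : α ∈ Form E M k) (hβ : β ∈ Form E M k) :
    extD (α + β) = extD α + extD β := by
  refine RawForm.ext_chartRep fun x => ?_
  have hx := mem_extChartAt_target (I := 𝓘(ℝ, E)) x
  rw [chartRep_extD ((Form E M k).add_mem hα hβ) hx, chartRep_add, chartRep_add, Pi.add_apply,
    chartRep_extD hα hx, chartRep_extD hβ hx]
  exact extDeriv_add (Form.differentiableAt_chartRep hα hx) (Form.differentiableAt_chartRep hβ hx)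

theorem extD_smul {k : ℕ} {α : RawForm E M k} (c : ℝ) (hα : α ∈ Form E M k) :
    extD (c • α) = c • extD α := by
  refine RawForm.ext_chartRep fun x => ?_
  have hx := mem_extChartAt_target (I := 𝓘(ℝ, E)) x
  rw [chartRep_extD ((Form E M k).smul_mem c hα) hx, chartRep_smul, chartRep_smul, Pi.smul_apply,
    chartRep_extD hα hx]
  exact extDeriv_smul c _

theorem extD_extD {k : ℕ} {α : RawForm E M k} (hα : α ∈ Form E M k) : extD (extD α) = 0 := by
  refine RawForm.ext_chartRep fun x => ?_
  have hx := mem_extChartAt_target (I := 𝓘(ℝ, E)) x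
  have hev : chartRep x (extD α) =ᶠ[nhds (extChartAt 𝓘(ℝ, E) x x)] extDeriv (chartRep x α) := by
    filter_upwards [(isOpen_target x).mem_nhds hx] with y hy using chartRep_extD hα hy
  rw [chartRep_extD (extD_mem hα) hx, hev.extDeriv_eq,
    extDeriv_extDeriv_apply (Form.contDiffAt_chartRep hα hx) two_le_infty]
  rfl

theorem mpullback_eq_fieldRep {x₀ : M} (X : VField E M) {y : E}
    (hy : y ∈ (extChartAt 𝓘(ℝ, E) x₀).target) :
    VectorField.mpullback 𝓘(ℝ, E) 𝓘(ℝ, E) (extChartAt 𝓘(ℝ, E) x₀).symm X y = fieldRep x₀ X y := by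
  have h : (chartSymmD x₀ y).inverse = chartD E x₀ ((extChartAt 𝓘(ℝ, E) x₀).symm y) :=
    ContinuousLinearMap.inverse_eq (chartSymmD_comp_chartD hy) (chartD_comp_chartSymmD hy)
  exact DFunLike.congr_fun h _

theorem contDiffAt_fieldRep [CompleteSpace E] {x₀ : M} (X : VField E M) {y : E}
    (hy : y ∈ (extChartAt 𝓘(ℝ, E) x₀).target) : ContDiffAt ℝ ∞ (fieldRep x₀ X) y := by
  have h₁ : ContMDiffAt 𝓘(ℝ, E) 𝓘(ℝ, E) ∞ (extChartAt 𝓘(ℝ, E) x₀).symm y :=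
    (contMDiffOn_extChartAt_symm x₀).contMDiffAt ((isOpen_target x₀).mem_nhds hy)
  have hinv : (chartSymmD x₀ y).IsInvertible :=
    ContinuousLinearMap.IsInvertible.of_inverse (chartSymmD_comp_chartD hy)
      (chartD_comp_chartSymmD hy)
  have h := ContMDiffAt.mpullback_vectorField_preimage (m := ∞) (n := ∞)
    (X.contMDiff_toFun ((extChartAt 𝓘(ℝ, E) x₀).symm y)) h₁ hinv (by simp)
  have h' := contMDiffAt_vectorSpace_iff_contDiffAt.1 h
  refine h'.congr_of_eventuallyEq ?_
  filter_upwards [(isOpen_target x₀).mem_nhds hy] with y' hy'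
  exact (mpullback_eq_fieldRep X hy').symm

theorem iota_mem [CompleteSpace E] {k : ℕ} (X : VField E M) {α : RawForm E M (k + 1)}
    (hα : α ∈ Form E M (k + 1)) : iota X α ∈ Form E M k := fun x₀ =>
  (contDiffOn_interior (fun _ hy => (contDiffAt_fieldRep X hy).contDiffWithinAt) (hα x₀)).congr
    fun _ hy => chartRep_iota X α hy

theorem chartRep_lieD [CompleteSpace E] {k : ℕ} {x₀ : M} (X : VField E M) {α : RawForm E M k}
    (hα : α ∈ Form E M k) {y : E} (hy : y ∈ (extChartAt 𝓘(ℝ, E) x₀).target) :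
    chartRep x₀ (lieD X α) y = lieFlat (fieldRep x₀ X) (chartRep x₀ α) y := by
  cases k with
  | zero => rw [lieD, lieFlat, chartRep_iota _ _ hy, chartRep_extD hα hy]
  | succ k =>
    have hev : chartRep x₀ (iota X α) =ᶠ[nhds y]
        fun y' => interior (fieldRep x₀ X y') (chartRep x₀ α y') := by
      filter_upwards [(isOpen_target x₀).mem_nhds hy] with y' hy' using chartRep_iota X α hy'
    rw [lieD, lieFlat, chartRep_add, Pi.add_apply, chartRep_iota _ _ hy, chartRep_extD hα hy,
      chartRep_extD (iota_mem X hα) hy, hev.extDeriv_eq]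

theorem mlieBracket_eq_chartSymmD (x : M) (X Y : VField E M) :
    (VectorField.mlieBracket 𝓘(ℝ, E) X Y x : E) =
      chartSymmD x (extChartAt 𝓘(ℝ, E) x x)
        (VectorField.lieBracket ℝ (fieldRep x X) (fieldRep x Y) (extChartAt 𝓘(ℝ, E) x x)) := by
  have hx := mem_extChartAt_target (I := 𝓘(ℝ, E)) x
  have hev (Z : VField E M) : (VectorField.mpullbackWithin 𝓘(ℝ, E) 𝓘(ℝ, E)
      (extChartAt 𝓘(ℝ, E) x).symm Z (Set.range 𝓘(ℝ, E)) : E → E)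
        =ᶠ[nhds (extChartAt 𝓘(ℝ, E) x x)] fieldRep x Z := by
    rw [ModelWithCorners.range_eq_univ, VectorField.mpullbackWithin_univ]
    filter_upwards [(isOpen_target x).mem_nhds hx] with y hy using mpullback_eq_fieldRep Z hy
  have h : (chartD E x x).inverse = chartSymmD x (extChartAt 𝓘(ℝ, E) x x) := by
    have h₁ := chartSymmD_comp_chartD (E := E) hx
    have h₂ := chartD_comp_chartSymmD (E := E) hx
    rw [extChartAt_to_inv] at h₁ h₂
    exact ContinuousLinearMap.inverse_eq h₂ h₁
  rw [← VectorField.mlieBracketWithin_univ, VectorField.mlieBracketWithin_apply, ← h,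
    Set.preimage_univ, Set.univ_inter, ModelWithCorners.range_eq_univ]
  have := Filter.EventuallyEq.lieBracket_vectorField_eq (𝕜 := ℝ) (hev X) (hev Y)
  rw [ModelWithCorners.range_eq_univ] at this
  exact congrArg (chartD E x x).inverse
    ((congrFun VectorField.lieBracketWithin_univ _).trans this)

theorem chartRep_interior_mlieBracket {k : ℕ} (x : M) (X Y : VField E M)
    (α : RawForm E M (k + 1)) :
    chartRep x (fun a => interior (VectorField.mlieBracket 𝓘(ℝ, E) X Y a) (α a))
      (extChartAt 𝓘(ℝ, E) x x) =
    interior (VectorField.lieBracket ℝ (fieldRep x X) (fieldRep x Y) (extChartAt 𝓘(ℝ, E) x x))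
      (chartRep x α (extChartAt 𝓘(ℝ, E) x x)) := by
  rw [chartRep_eq, chartRep_eq, interior_compContinuousLinearMap, extChartAt_to_inv,
    ← mlieBracket_eq_chartSymmD]
  rfl

/-- `[L_X, ι_Y] = ι_{[X, Y]}`. -/
theorem lieD_iota [CompleteSpace E] {k : ℕ} (X Y : VField E M) {α : RawForm E M (k + 1)}
    (hα : α ∈ Form E M (k + 1)) :
    lieD X (iota Y α) = iota Y (lieD X α) +
      fun a => interior (VectorField.mlieBracket 𝓘(ℝ, E) X Y a) (α a) := by
  refine RawForm.ext_chartRep fun x => ?_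
  have hx := mem_extChartAt_target (I := 𝓘(ℝ, E)) x
  have hev : chartRep x (iota Y α) =ᶠ[nhds (extChartAt 𝓘(ℝ, E) x x)]
      fun y => interior (fieldRep x Y y) (chartRep x α y) := by
    filter_upwards [(isOpen_target x).mem_nhds hx] with y hy using chartRep_iota Y α hy
  rw [chartRep_lieD X (iota_mem Y hα) hx, chartRep_add, Pi.add_apply, chartRep_iota _ _ hx,
    chartRep_lieD X hα hx, chartRep_interior_mlieBracket, lieFlat_congr hev]
  exact lieFlat_interior ((contDiffAt_fieldRep X hx).differentiableAt (by simp))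
    ((contDiffAt_fieldRep Y hx).differentiableAt (by simp)) (Form.differentiableAt_chartRep hα hx)

end Charts

section ExteriorAlgebra

open ExteriorAlgebra

variable {V : Type*} [AddCommGroup V] [Module ℝ V]

@[elab_as_elim]
theorem exteriorAlgebra_left_induction {P : ExteriorAlgebra ℝ V → Prop}
    (algebraMap : ∀ r : ℝ, P (algebraMap _ _ r)) (add : ∀ x y, P x → P y → P (x + y))
    (ι_mul : ∀ x m, P x → P (ι ℝ m * x)) : ∀ x, P x := fun x =>
  CliffordAlgebra.left_induction (P := P) (0 : QuadraticForm ℝ V) algebraMap add ι_mul x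

@[elab_as_elim]
theorem exteriorAlgebra_right_induction {P : ExteriorAlgebra ℝ V → Prop}
    (algebraMap : ∀ r : ℝ, P (algebraMap _ _ r)) (add : ∀ x y, P x → P y → P (x + y))
    (mul_ι : ∀ m x, P x → P (x * ι ℝ m)) : ∀ x, P x := fun x =>
  CliffordAlgebra.right_induction (P := P) (0 : QuadraticForm ℝ V) algebraMap add mul_ι x

variable (V) in
/-- The grade involution of the exterior algebra. -/
def parity : ExteriorAlgebra ℝ V →ₐ[ℝ] ExteriorAlgebra ℝ V := CliffordAlgebra.involute

@[simp]
theorem parity_ι (x : V) : parity V (ι ℝ x) = -ι ℝ x := CliffordAlgebra.involute_ι x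

theorem parity_parity (q : ExteriorAlgebra ℝ V) : parity V (parity V q) = q :=
  CliffordAlgebra.involute_involute q

theorem ι_mul_ι_swap (x y : V) : ι ℝ x * ι ℝ y = -(ι ℝ y * ι ℝ x) :=
  eq_neg_of_add_eq_zero_left (ι_add_mul_swap x y)

theorem mul_ι_eq_ι_mul_parity (q : ExteriorAlgebra ℝ V) (z : V) :
    q * ι ℝ z = ι ℝ z * parity V q := by
  induction q using exteriorAlgebra_left_induction with
  | algebraMap r => rw [AlgHom.commutes, Algebra.commutes]
  | add a b ha hb => rw [add_mul, ha, hb, map_add, mul_add]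
  | ι_mul q y h =>
    rw [mul_assoc, h, ← mul_assoc, ι_mul_ι_swap, map_mul, parity_ι, neg_mul, neg_mul, mul_neg,
      mul_assoc]

theorem coe_exteriorPower_map {W : Type*} [AddCommGroup W] [Module ℝ W] (k : ℕ) (φ : V →ₗ[ℝ] W)
    (p : ⋀[ℝ]^k V) :
    (exteriorPower.map k φ p : ExteriorAlgebra ℝ W) = ExteriorAlgebra.map φ p := by
  have : (⋀[ℝ]^k W).subtype ∘ₗ exteriorPower.map k φ =
      (ExteriorAlgebra.map φ).toLinearMap ∘ₗ (⋀[ℝ]^k V).subtype := by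
    apply exteriorPower.linearMap_ext
    ext x
    simp [ExteriorAlgebra.map_apply_ιMulti]
  exact LinearMap.congr_fun this p

end ExteriorAlgebra

section Homology

open ExteriorAlgebra

variable {𝔤 : Type*} [LieRing 𝔤] [LieAlgebra ℝ 𝔤]

theorem boundaryExt_algebraMap (r : ℝ) :
    boundaryExt (algebraMap ℝ (ExteriorAlgebra ℝ 𝔤) r) = 0 := by
  rw [Algebra.algebraMap_eq_smul_one, map_smul, boundaryExt_one, smul_zero]

theorem adExt_ι (y x : 𝔤) : adExt y (ι ℝ x) = ι ℝ ⁅y, x⁆ := by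
  simpa [adExt_one] using adExt_ι_mul y x 1

theorem boundaryExt_ι (x : 𝔤) : boundaryExt (ι ℝ x) = 0 := by
  simpa [adExt_one, boundaryExt_one] using boundaryExt_ι_mul x 1

theorem adExt_mul_ι (y x : 𝔤) (q : ExteriorAlgebra ℝ 𝔤) :
    adExt y (q * ι ℝ x) = adExt y q * ι ℝ x + q * ι ℝ ⁅y, x⁆ := by
  induction q using exteriorAlgebra_left_induction with
  | algebraMap r =>
    rw [adExt_algebraMap, zero_mul, zero_add, Algebra.algebraMap_eq_smul_one, smul_one_mul,
      map_smul, adExt_ι, smul_one_mul]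
  | add a b ha hb => simp only [add_mul, map_add, ha, hb]; abel
  | ι_mul q z h => rw [mul_assoc, adExt_ι_mul, h, adExt_ι_mul]; noncomm_ring

theorem adExt_parity (y : 𝔤) (q : ExteriorAlgebra ℝ 𝔤) :
    adExt y (parity 𝔤 q) = parity 𝔤 (adExt y q) := by
  induction q using exteriorAlgebra_left_induction with
  | algebraMap r => rw [AlgHom.commutes, adExt_algebraMap, map_zero]
  | add a b ha hb => simp only [map_add, ha, hb]
  | ι_mul q z h =>
    rw [map_mul, parity_ι, neg_mul, map_neg, adExt_ι_mul, h, adExt_ι_mul, map_add, map_mul,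
      map_mul, parity_ι, parity_ι]
    noncomm_ring

theorem boundaryExt_mul_ι (x : 𝔤) (q : ExteriorAlgebra ℝ 𝔤) :
    boundaryExt (q * ι ℝ x) = boundaryExt q * ι ℝ x - adExt x (parity 𝔤 q) := by
  induction q using exteriorAlgebra_left_induction with
  | algebraMap r =>
    rw [AlgHom.commutes, adExt_algebraMap, boundaryExt_algebraMap, zero_mul, sub_zero,
      Algebra.algebraMap_eq_smul_one, smul_one_mul, map_smul, boundaryExt_ι, smul_zero]
  | add a b ha hb => simp only [add_mul, map_add, ha, hb]; abel
  | ι_mul q z h =>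
    rw [mul_assoc, boundaryExt_ι_mul, h, boundaryExt_ι_mul, adExt_mul_ι, map_mul, parity_ι,
      neg_mul, map_neg, adExt_ι_mul, mul_ι_eq_ι_mul_parity q ⁅z, x⁆, ← lie_skew x z, map_neg]
    noncomm_ring

theorem coe_boundary (k : ℕ) (p : ⋀[ℝ]^(k + 1) 𝔤) :
    (boundary k p : ExteriorAlgebra ℝ 𝔤) = boundaryExt (p : ExteriorAlgebra ℝ 𝔤) := by
  have : (⋀[ℝ]^k 𝔤).subtype ∘ₗ boundary k = boundaryExt ∘ₗ (⋀[ℝ]^(k + 1) 𝔤).subtype := by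
    apply exteriorPower.linearMap_ext
    ext x
    cases k with
    | zero => simp [boundary, ExteriorAlgebra.ιMulti_succ_apply, boundaryExt_ι]
    | succ k =>
      simp only [LinearMap.compAlternatingMap_apply, LinearMap.comp_apply, boundary,
        exteriorPower.alternatingMapLinearEquiv_apply_ιMulti, Submodule.subtype_apply,
        exteriorPower.ιMulti_apply_coe]
      exact coe_boundaryFun x
  exact LinearMap.congr_fun this p

theorem boundaryExt_eq_zero_of_mem_cycles {k : ℕ} {p : ⋀[ℝ]^k 𝔤} (hp : p ∈ cycles 𝔤 k) :
    boundaryExt (p : ExteriorAlgebra ℝ 𝔤) = 0 := by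
  cases k with
  | zero =>
    obtain ⟨p, hp'⟩ := p
    rw [exteriorPower, pow_zero, Submodule.mem_one] at hp'
    obtain ⟨r, rfl⟩ := hp'
    exact boundaryExt_algebraMap r
  | succ k =>
    rw [← coe_boundary, show boundary k p = 0 from hp]
    rfl

section Map

variable {𝔥 : Type*} [LieRing 𝔥] [LieAlgebra ℝ 𝔥] {φ : 𝔤 →ₗ[ℝ] 𝔥}

theorem adExt_map (hφ : ∀ x y, φ ⁅x, y⁆ = ⁅φ x, φ y⁆) (y : 𝔤) (q : ExteriorAlgebra ℝ 𝔤) :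
    adExt (φ y) (ExteriorAlgebra.map φ q) = ExteriorAlgebra.map φ (adExt y q) := by
  induction q using exteriorAlgebra_left_induction with
  | algebraMap r => rw [AlgHom.commutes, adExt_algebraMap, adExt_algebraMap, map_zero]
  | add a b ha hb => simp only [map_add, ha, hb]
  | ι_mul q z h => simp only [map_mul, map_apply_ι, adExt_ι_mul, h, map_add, hφ]

theorem boundaryExt_map (hφ : ∀ x y, φ ⁅x, y⁆ = ⁅φ x, φ y⁆) (q : ExteriorAlgebra ℝ 𝔤) :
    boundaryExt (ExteriorAlgebra.map φ q) = ExteriorAlgebra.map φ (boundaryExt q) := by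
  induction q using exteriorAlgebra_left_induction with
  | algebraMap r => rw [AlgHom.commutes, boundaryExt_algebraMap, boundaryExt_algebraMap, map_zero]
  | add a b ha hb => simp only [map_add, ha, hb]
  | ι_mul q z h =>
    simp only [map_mul, map_apply_ι, boundaryExt_ι_mul, h, map_sub, map_neg, adExt_map hφ]

theorem boundary_map (hφ : ∀ x y, φ ⁅x, y⁆ = ⁅φ x, φ y⁆) (k : ℕ) (p : ⋀[ℝ]^(k + 1) 𝔤) :
    boundary k (exteriorPower.map (k + 1) φ p) = exteriorPower.map k φ (boundary k p) := by
  apply Subtype.ext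
  rw [coe_boundary, coe_exteriorPower_map, coe_exteriorPower_map, coe_boundary, boundaryExt_map hφ]

end Map

end Homology

section Extension

open ExteriorAlgebra

variable {𝔤 : Type*} [LieRing 𝔤] [LieAlgebra ℝ 𝔤]

variable (𝔤) in
/-- The map of exterior algebras induced by the inclusion `𝔤 → 𝔤 ⊕ ℝc`. -/
def inlExt : ExteriorAlgebra ℝ 𝔤 →ₐ[ℝ] ExteriorAlgebra ℝ (𝔤 × ℝ) :=
  ExteriorAlgebra.map (LinearMap.inl ℝ 𝔤 ℝ)

variable (𝔤) in
/-- The map of exterior algebras induced by the projection `𝔤 ⊕ ℝc → 𝔤`. -/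
def fstExt : ExteriorAlgebra ℝ (𝔤 × ℝ) →ₐ[ℝ] ExteriorAlgebra ℝ 𝔤 :=
  ExteriorAlgebra.map (LinearMap.fst ℝ 𝔤 ℝ)

/-- Contraction from the right with the coordinate functional of `c`. -/
def contractC : ExteriorAlgebra ℝ (𝔤 × ℝ) →ₗ[ℝ] ExteriorAlgebra ℝ (𝔤 × ℝ) :=
  (CliffordAlgebra.contractRight (Q := (0 : QuadraticForm ℝ (𝔤 × ℝ)))).flip (LinearMap.snd ℝ 𝔤 ℝ)

variable (𝔤) in
/-- The component `q₁` in the decomposition `q = q₀ + q₁ ∧ c` of `Λ(𝔤 ⊕ ℝc)`. -/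
def cPart : ExteriorAlgebra ℝ (𝔤 × ℝ) →ₗ[ℝ] ExteriorAlgebra ℝ 𝔤 :=
  (fstExt 𝔤).toLinearMap ∘ₗ contractC

theorem contractC_algebraMap (r : ℝ) :
    contractC (algebraMap ℝ (ExteriorAlgebra ℝ (𝔤 × ℝ)) r) = 0 :=
  CliffordAlgebra.contractRight_algebraMap _ _ r

theorem contractC_mul_ι (q : ExteriorAlgebra ℝ (𝔤 × ℝ)) (x : 𝔤 × ℝ) :
    contractC (q * ι ℝ x) = x.2 • q - contractC q * ι ℝ x :=
  CliffordAlgebra.contractRight_mul_ι _ _ _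

theorem fstExt_inlExt (q : ExteriorAlgebra ℝ 𝔤) : fstExt 𝔤 (inlExt 𝔤 q) = q := by
  have : (fstExt 𝔤).comp (inlExt 𝔤) = AlgHom.id ℝ _ := by
    rw [fstExt, inlExt, ExteriorAlgebra.map_comp_map, LinearMap.fst_comp_inl,
      ExteriorAlgebra.map_id]
  exact DFunLike.congr_fun this q

theorem fstExt_ι (x : 𝔤 × ℝ) : fstExt 𝔤 (ι ℝ x) = ι ℝ x.1 := map_apply_ι _ _

theorem inlExt_ι (x : 𝔤) : inlExt 𝔤 (ι ℝ x) = ι ℝ (x, (0 : ℝ)) := map_apply_ι _ _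

theorem cPart_algebraMap (r : ℝ) : cPart 𝔤 (algebraMap ℝ _ r) = 0 := by
  rw [cPart, LinearMap.comp_apply, contractC_algebraMap, map_zero]

theorem cPart_mul_ι (q : ExteriorAlgebra ℝ (𝔤 × ℝ)) (x : 𝔤 × ℝ) :
    cPart 𝔤 (q * ι ℝ x) = x.2 • fstExt 𝔤 q - cPart 𝔤 q * ι ℝ x.1 := by
  simp only [cPart, LinearMap.comp_apply, contractC_mul_ι, AlgHom.toLinearMap_apply, map_sub,
    map_smul, map_mul, fstExt_ι]

theorem cPart_inlExt (q : ExteriorAlgebra ℝ 𝔤) : cPart 𝔤 (inlExt 𝔤 q) = 0 := by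
  induction q using exteriorAlgebra_right_induction with
  | algebraMap r => rw [AlgHom.commutes, cPart_algebraMap]
  | add a b ha hb => rw [map_add, map_add, ha, hb, add_zero]
  | mul_ι x q h => rw [map_mul, inlExt_ι, cPart_mul_ι, h, zero_smul, zero_mul, sub_zero]

theorem cPart_inlExt_mul_ι (q : ExteriorAlgebra ℝ 𝔤) :
    cPart 𝔤 (inlExt 𝔤 q * ι ℝ ((0 : 𝔤), (1 : ℝ))) = q := by
  rw [cPart_mul_ι, cPart_inlExt, fstExt_inlExt, one_smul, zero_mul, sub_zero]

/-- The decomposition `q = q₀ + q₁ ∧ c` of `Λ(𝔤 ⊕ ℝc)`. -/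
theorem inlExt_add_inlExt_mul_ι (q : ExteriorAlgebra ℝ (𝔤 × ℝ)) :
    inlExt 𝔤 (fstExt 𝔤 q) + inlExt 𝔤 (cPart 𝔤 q) * ι ℝ ((0 : 𝔤), (1 : ℝ)) = q := by
  induction q using exteriorAlgebra_right_induction with
  | algebraMap r => rw [cPart_algebraMap, AlgHom.commutes, AlgHom.commutes, map_zero, zero_mul,
      add_zero]
  | add a b ha hb =>
    nth_rewrite 3 [← ha]
    nth_rewrite 3 [← hb]
    simp only [map_add, add_mul]
    abel
  | mul_ι x q h =>
    have hx : ι ℝ x = ι ℝ (x.1, (0 : ℝ)) + x.2 • ι ℝ ((0 : 𝔤), (1 : ℝ)) := by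
      rw [← map_smul, ← map_add]
      simp
    nth_rewrite 3 [← h]
    rw [cPart_mul_ι, map_mul, fstExt_ι, map_mul, inlExt_ι, map_sub, map_smul, map_mul, inlExt_ι,
      sub_mul, mul_assoc _ (ι ℝ (x.1, (0 : ℝ))), ι_mul_ι_swap, add_mul, hx, mul_add, mul_add,
      mul_assoc _ (ι ℝ ((0 : 𝔤), (1 : ℝ))) (x.2 • _), mul_smul_comm, mul_smul_comm, ι_sq_zero,
      smul_zero, mul_zero, smul_mul_assoc]
    noncomm_ring

theorem fst_lie (x y : 𝔤 × ℝ) :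
    LinearMap.fst ℝ 𝔤 ℝ ⁅x, y⁆ = ⁅LinearMap.fst ℝ 𝔤 ℝ x, LinearMap.fst ℝ 𝔤 ℝ y⁆ := rfl

theorem inl_lie (x y : 𝔤) :
    LinearMap.inl ℝ 𝔤 ℝ ⁅x, y⁆ = ⁅LinearMap.inl ℝ 𝔤 ℝ x, LinearMap.inl ℝ 𝔤 ℝ y⁆ := rfl

theorem adExt_c (q : ExteriorAlgebra ℝ (𝔤 × ℝ)) : adExt ((0 : 𝔤), (1 : ℝ)) q = 0 := by
  induction q using exteriorAlgebra_left_induction with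
  | algebraMap r => rw [adExt_algebraMap]
  | add a b ha hb => rw [map_add, ha, hb, add_zero]
  | ι_mul q z h =>
    have hz : ⁅((0 : 𝔤), (1 : ℝ)), z⁆ = 0 := Prod.ext (zero_lie z.1) rfl
    rw [adExt_ι_mul, h, hz, map_zero, zero_mul, mul_zero, add_zero]

theorem cPart_boundaryExt (q : ExteriorAlgebra ℝ (𝔤 × ℝ)) :
    cPart 𝔤 (boundaryExt q) = boundaryExt (cPart 𝔤 q) := by
  conv_lhs => rw [← inlExt_add_inlExt_mul_ι q]
  rw [map_add, boundaryExt_mul_ι, adExt_c, sub_zero, inlExt, boundaryExt_map inl_lie,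
    boundaryExt_map inl_lie, ← inlExt, map_add, cPart_inlExt, cPart_inlExt_mul_ι, zero_add]

theorem contractC_mem (k : ℕ) {q : ExteriorAlgebra ℝ (𝔤 × ℝ)} (hq : q ∈ ⋀[ℝ]^(k + 1) (𝔤 × ℝ)) :
    contractC q ∈ ⋀[ℝ]^k (𝔤 × ℝ) := by
  induction k generalizing q with
  | zero =>
    rw [exteriorPower, zero_add, pow_one] at hq
    obtain ⟨x, rfl⟩ := hq
    have := contractC_mul_ι 1 x
    rw [one_mul, ← map_one (algebraMap ℝ _), contractC_algebraMap, zero_mul, sub_zero] at this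
    rw [this, exteriorPower, pow_zero]
    exact Submodule.smul_mem _ _ (Submodule.mem_one.2 ⟨1, rfl⟩)
  | succ k ih =>
    rw [exteriorPower, pow_succ] at hq
    induction hq using Submodule.mul_induction_on' with
    | mem_mul_mem a ha b hb =>
      obtain ⟨x, rfl⟩ := hb
      rw [contractC_mul_ι]
      refine Submodule.sub_mem _ (Submodule.smul_mem _ _ ha) ?_
      rw [exteriorPower, pow_succ]
      exact Submodule.mul_mem_mul (ih ha) ⟨x, rfl⟩
    | add a _ b _ ha hb => rw [map_add]; exact Submodule.add_mem _ ha hb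

theorem coe_tensorC {k : ℕ} (p : ⋀[ℝ]^k 𝔤) :
    (tensorC p : ExteriorAlgebra ℝ (𝔤 × ℝ)) =
      inlExt 𝔤 (p : ExteriorAlgebra ℝ 𝔤) * ι ℝ ((0 : 𝔤), (1 : ℝ)) :=
  congrArg (· * ι ℝ ((0 : 𝔤), (1 : ℝ))) (coe_exteriorPower_map k (LinearMap.inl ℝ 𝔤 ℝ) p)

/-- Every element of `Λ^{k+1}(𝔤 ⊕ ℝc)` is of the form `p₀ + p₁ ⊗ c`. -/
theorem exists_map_inl_add_tensorC (k : ℕ) (P : ⋀[ℝ]^(k + 1) (𝔤 × ℝ)) :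
    ∃ (p₀ : ⋀[ℝ]^(k + 1) 𝔤) (p₁ : ⋀[ℝ]^k 𝔤),
      exteriorPower.map (k + 1) (LinearMap.inl ℝ 𝔤 ℝ) p₀ + tensorC p₁ = P := by
  refine ⟨exteriorPower.map (k + 1) (LinearMap.fst ℝ 𝔤 ℝ) P,
    exteriorPower.map k (LinearMap.fst ℝ 𝔤 ℝ) ⟨_, contractC_mem k P.2⟩, Subtype.ext ?_⟩
  rw [Submodule.coe_add, coe_tensorC, coe_exteriorPower_map, coe_exteriorPower_map,
    coe_exteriorPower_map]
  exact inlExt_add_inlExt_mul_ι _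

end Extension

section Graded

variable {E : Type*} [NormedAddCommGroup E] [NormedSpace ℝ E]
  {M : Type*} [TopologicalSpace M] [ChartedSpace E M]

variable (E M) in
/-- The graded space of smooth forms. -/
def GForm : Type _ := ∀ j : ℕ, Form E M j

instance : AddCommGroup (GForm E M) := inferInstanceAs (AddCommGroup (∀ j : ℕ, Form E M j))

instance : Module ℝ (GForm E M) := inferInstanceAs (Module ℝ (∀ j : ℕ, Form E M j))

@[ext]
theorem GForm.ext {α β : GForm E M} (h : ∀ j, α j = β j) : α = β := funext h

variable [IsManifold 𝓘(ℝ, E) ∞ M]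

/-- The exterior derivative of smooth forms. -/
def dForm {k : ℕ} : Form E M k →ₗ[ℝ] Form E M (k + 1) where
  toFun α := ⟨extD (α : RawForm E M k), extD_mem α.2⟩
  map_add' α β := Subtype.ext (extD_add α.2 β.2)
  map_smul' c α := Subtype.ext (extD_smul c α.2)

/-- The exterior derivative on the graded space of smooth forms. -/
def dG : Module.End ℝ (GForm E M) where
  toFun β
    | 0 => 0
    | _ + 1 => dForm (β _)
  map_add' α β := by
    funext j
    cases j with
    | zero => exact (add_zero _).symm
    | succ j => exact map_add dForm _ _
  map_smul' c β := by
    funext j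
    cases j with
    | zero => exact (smul_zero c).symm
    | succ j => exact map_smul dForm _ _

theorem dG_dG (β : GForm E M) : dG (dG β) = 0 := by
  funext j
  match j with
  | 0 => rfl
  | 1 => exact map_zero dForm
  | j + 2 => exact Subtype.ext (extD_extD (β j).2)

variable [CompleteSpace E]

/-- The interior product of smooth forms. -/
def iotaForm {k : ℕ} (X : VField E M) : Form E M (k + 1) →ₗ[ℝ] Form E M k where
  toFun α := ⟨iota X (α : RawForm E M (k + 1)), iota_mem X α.2⟩
  map_add' _ _ := rfl
  map_smul' _ _ := rfl

omit [CompleteSpace E] in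
theorem interior_add_left {k : ℕ} (X Y : E) (a : E [⋀^Fin (k + 1)]→L[ℝ] ℝ) :
    interior (X + Y) a = interior X a + interior Y a := map_add a.curryLeft X Y

omit [CompleteSpace E] in
theorem interior_smul_left {k : ℕ} (c : ℝ) (X : E) (a : E [⋀^Fin (k + 1)]→L[ℝ] ℝ) :
    interior (c • X) a = c • interior X a := map_smul a.curryLeft c X

variable (E M) in
/-- The interior product on the graded space of smooth forms. -/
def iotaG : VField E M →ₗ[ℝ] Module.End ℝ (GForm E M) where
  toFun X :=
    { toFun := fun β j => iotaForm X (β (j + 1))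
      map_add' := fun _ _ => rfl
      map_smul' := fun _ _ => rfl }
  map_add' X Y := by
    ext β j a : 4
    exact interior_add_left (E := E) (fieldAt X a) (fieldAt Y a) (formAt (β (j + 1)).1 a)
  map_smul' c X := by
    ext β j a : 4
    exact interior_smul_left (E := E) c (fieldAt X a) (formAt (β (j + 1)).1 a)

theorem iotaG_iotaG_self (X : VField E M) (β : GForm E M) : iotaG E M X (iotaG E M X β) = 0 := by
  funext j
  refine Subtype.ext (funext fun a => ?_)
  ext w
  exact ((β (j + 2)).1 a).map_eq_zero_of_eq _ (i := 0) (j := 1) rfl (by simp)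

theorem iotaG_iotaG_swap (X Y : VField E M) (β : GForm E M) :
    iotaG E M X (iotaG E M Y β) = -iotaG E M Y (iotaG E M X β) := by
  have h := iotaG_iotaG_self (X + Y) β
  simp only [map_add, LinearMap.add_apply, iotaG_iotaG_self, zero_add, add_zero] at h
  exact eq_neg_of_add_eq_zero_left ((add_comm _ _).trans h)

/-- The Lie derivative on the graded space of smooth forms. -/
def lieG (X : VField E M) : Module.End ℝ (GForm E M) := dG * iotaG E M X + iotaG E M X * dG

theorem lieG_apply (X : VField E M) (β : GForm E M) :
    lieG X β = dG (iotaG E M X β) + iotaG E M X (dG β) := rfl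

theorem coe_lieG (X : VField E M) (β : GForm E M) (j : ℕ) :
    (lieG X β j : RawForm E M j) = lieD X (β j : RawForm E M j) := by
  cases j with
  | zero => exact zero_add _
  | succ j => rfl

theorem lieG_iotaG {X Y Z : VField E M}
    (h : ∀ a : M, Z a = VectorField.mlieBracket 𝓘(ℝ, E) X Y a) (β : GForm E M) :
    lieG X (iotaG E M Y β) = iotaG E M Y (lieG X β) + iotaG E M Z β := by
  funext j
  apply Subtype.ext
  rw [coe_lieG]
  refine (lieD_iota X Y (β (j + 1)).2).trans ?_
  rw [← coe_lieG]
  simp only [← h]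
  rfl

/-- The homogeneous component of degree `j`. -/
def degPart (j : ℕ) : GForm E M →ₗ[ℝ] Form E M j := LinearMap.proj (φ := fun j => Form E M j) j

omit [CompleteSpace E] in
theorem degPart_succ_dG (j : ℕ) (β : GForm E M) :
    degPart (j + 1) (dG β) = dForm (degPart j β) := rfl

omit [CompleteSpace E] in
theorem degPart_zero_dG (β : GForm E M) : degPart 0 (dG β) = 0 := rfl

variable (E M) in
/-- A smooth form as a homogeneous element of the graded space. -/
def homog (N : ℕ) : Form E M N →ₗ[ℝ] GForm E M :=
  LinearMap.single ℝ (fun j => Form E M j) N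

omit [IsManifold 𝓘(ℝ, E) ∞ M] [CompleteSpace E] in
@[simp]
theorem homog_self {N : ℕ} (α : Form E M N) : homog E M N α N = α :=
  Pi.single_eq_same (M := fun j => Form E M j) N α

omit [IsManifold 𝓘(ℝ, E) ∞ M] [CompleteSpace E] in
theorem homog_of_ne {N j : ℕ} (h : j ≠ N) (α : Form E M N) : homog E M N α j = 0 :=
  Pi.single_eq_of_ne (M := fun j => Form E M j) h α

theorem iotaG_homog {N : ℕ} (X : VField E M) (α : Form E M (N + 1)) :
    iotaG E M X (homog E M (N + 1) α) = homog E M N (iotaForm X α) := by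
  funext j
  change iotaForm X (homog E M (N + 1) α (j + 1)) = _
  by_cases h : j = N
  · subst h; simp
  · rw [homog_of_ne h, homog_of_ne (by omega), map_zero]

omit [CompleteSpace E] in
theorem dG_homog {N : ℕ} (α : Form E M N) :
    dG (homog E M N α) = homog E M (N + 1) (dForm α) := by
  funext j
  cases j with
  | zero => exact (homog_of_ne (by omega) _).symm
  | succ j =>
    change dForm (homog E M N α j) = _
    by_cases h : j = N
    · subst h; simp
    · rw [homog_of_ne h, homog_of_ne (by omega), map_zero]

theorem lieG_homog {N : ℕ} {X : VField E M} {α : Form E M N}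
    (h : lieD X (α : RawForm E M N) = 0) : lieG X (homog E M N α) = 0 := by
  funext j
  apply Subtype.ext
  rw [coe_lieG]
  by_cases hj : j = N
  · subst hj; rw [homog_self]; exact h
  · have := coe_lieG X (0 : GForm E M) j
    rw [map_zero] at this
    rw [homog_of_ne hj]
    exact this.symm

/-- The operator `(-1)^j` on forms of degree `j`. -/
def signG : Module.End ℝ (GForm E M) where
  toFun β j := (-1 : ℝ) ^ j • β j
  map_add' _ _ := funext fun _ => smul_add _ _ _
  map_smul' c β := funext fun j => smul_comm ((-1 : ℝ) ^ j) c (β j)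

theorem iotaG_signG (X : VField E M) (β : GForm E M) :
    iotaG E M X (signG β) = -signG (iotaG E M X β) := by
  funext j
  change iotaForm X ((-1 : ℝ) ^ (j + 1) • β (j + 1)) = -((-1 : ℝ) ^ j • iotaForm X (β (j + 1)))
  rw [map_smul, pow_succ, mul_neg_one]
  exact neg_smul ((-1 : ℝ) ^ j) (iotaForm X (β (j + 1)))

omit [IsManifold 𝓘(ℝ, E) ∞ M] [CompleteSpace E] in
theorem signG_homog {N : ℕ} (α : Form E M N) :
    signG (homog E M N α) = (-1 : ℝ) ^ N • homog E M N α := by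
  funext j
  change (-1 : ℝ) ^ j • homog E M N α j = (-1 : ℝ) ^ N • homog E M N α j
  by_cases h : j = N
  · rw [h]
  · rw [homog_of_ne h, smul_zero, smul_zero]

end Graded

section Contraction

open ExteriorAlgebra

variable {E : Type*} [NormedAddCommGroup E] [NormedSpace ℝ E] [CompleteSpace E]
  {M : Type*} [TopologicalSpace M] [ChartedSpace E M] [IsManifold 𝓘(ℝ, E) ∞ M]

section Linear

variable {V : Type*} [AddCommGroup V] [Module ℝ V]

/-- The contraction `q ↦ ι(v_q)`, as an antihomomorphism from the exterior algebra. -/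
def contrOp (v : V →ₗ[ℝ] VField E M) :
    ExteriorAlgebra ℝ V →ₐ[ℝ] (Module.End ℝ (GForm E M))ᵐᵒᵖ :=
  ExteriorAlgebra.lift ℝ
    ⟨(MulOpposite.opLinearEquiv ℝ).toLinearMap ∘ₗ iotaG E M ∘ₗ v, fun x =>
      MulOpposite.unop_injective (LinearMap.ext fun β => iotaG_iotaG_self (v x) β)⟩

/-- The contraction `ι(v_q)` on the graded space of smooth forms. -/
def contr (v : V →ₗ[ℝ] VField E M) : ExteriorAlgebra ℝ V →ₗ[ℝ] Module.End ℝ (GForm E M) :=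
  (MulOpposite.opLinearEquiv ℝ).symm.toLinearMap ∘ₗ (contrOp v).toLinearMap

variable (v : V →ₗ[ℝ] VField E M)

theorem contr_mul (p q : ExteriorAlgebra ℝ V) : contr v (p * q) = contr v q * contr v p := by
  change (contrOp v (p * q)).unop = _
  rw [map_mul]
  rfl

theorem contr_mul_apply (p q : ExteriorAlgebra ℝ V) (β : GForm E M) :
    contr v (p * q) β = contr v q (contr v p β) := by
  rw [contr_mul]
  rfl

theorem contr_algebraMap (r : ℝ) (β : GForm E M) :
    contr v (algebraMap ℝ _ r) β = r • β := by
  change (contrOp v (algebraMap ℝ _ r)).unop β = _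
  rw [AlgHom.commutes]
  rfl

theorem contr_one (β : GForm E M) : contr v 1 β = β := by
  simpa using contr_algebraMap v 1 β

theorem contr_ι (x : V) : contr v (ι ℝ x) = iotaG E M (v x) := by
  change (contrOp v (ι ℝ x)).unop = _
  rw [contrOp, ExteriorAlgebra.lift_ι_apply]
  rfl

theorem contr_map {W : Type*} [AddCommGroup W] [Module ℝ W] (φ : W →ₗ[ℝ] V)
    (q : ExteriorAlgebra ℝ W) : contr v (ExteriorAlgebra.map φ q) = contr (v ∘ₗ φ) q := by
  ext β : 1
  induction q using exteriorAlgebra_left_induction generalizing β with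
  | algebraMap r => rw [AlgHom.commutes, contr_algebraMap, contr_algebraMap]
  | add a b ha hb => simp only [map_add, LinearMap.add_apply, ha, hb]
  | ι_mul q x h =>
    rw [map_mul, map_apply_ι, contr_mul_apply, contr_mul_apply, contr_ι, contr_ι, h]
    rfl

theorem iotaG_contr (X : VField E M) (q : ExteriorAlgebra ℝ V) (β : GForm E M) :
    iotaG E M X (contr v q β) = contr v (parity V q) (iotaG E M X β) := by
  induction q using exteriorAlgebra_left_induction generalizing β with
  | algebraMap r => rw [AlgHom.commutes, contr_algebraMap, contr_algebraMap, map_smul]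
  | add a b ha hb => simp only [map_add, LinearMap.add_apply, ha, hb]
  | ι_mul q x h =>
    rw [map_mul (parity V), parity_ι, contr_mul_apply, contr_mul_apply, contr_ι, h,
      iotaG_iotaG_swap, map_neg, map_neg, contr_ι, LinearMap.neg_apply, map_neg]

theorem contr_parity_signG (q : ExteriorAlgebra ℝ V) (β : GForm E M) :
    contr v (parity V q) (signG β) = signG (contr v q β) := by
  induction q using exteriorAlgebra_left_induction generalizing β with
  | algebraMap r => rw [AlgHom.commutes, contr_algebraMap, contr_algebraMap, map_smul]
  | add a b ha hb => simp only [map_add, LinearMap.add_apply, ha, hb]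
  | ι_mul q x h =>
    rw [map_mul (parity V), parity_ι, contr_mul_apply, contr_mul_apply, map_neg, contr_ι,
      LinearMap.neg_apply, iotaG_signG, neg_neg, h]

theorem contr_parity_homog (q : ExteriorAlgebra ℝ V) {N : ℕ} (α : Form E M N) (j : ℕ) :
    degPart j (contr v (parity V q) (homog E M N α)) =
      (-1 : ℝ) ^ (N + j) • degPart j (contr v q (homog E M N α)) := by
  have h := congrArg (degPart j) (contr_parity_signG v q (homog E M N α))
  rw [signG_homog, map_smul, map_smul] at h
  have h' : (-1 : ℝ) ^ N • degPart j (contr v (parity V q) (homog E M N α)) =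
      (-1 : ℝ) ^ j • degPart j (contr v q (homog E M N α)) := h
  rw [pow_add, mul_smul, ← h', smul_smul, ← mul_pow]
  simp

end Linear

section Action

variable {𝔤 : Type*} [LieRing 𝔤] [LieAlgebra ℝ 𝔤] {v : 𝔤 →ₗ[ℝ] VField E M}

theorem lieG_contr (hv : ∀ (x y : 𝔤) (a : M),
      v ⁅x, y⁆ a = VectorField.mlieBracket 𝓘(ℝ, E) (v x) (v y) a)
    (x : 𝔤) (q : ExteriorAlgebra ℝ 𝔤) (β : GForm E M) :
    lieG (v x) (contr v q β) = contr v q (lieG (v x) β) + contr v (adExt x q) β := by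
  induction q using exteriorAlgebra_left_induction generalizing β with
  | algebraMap r =>
    rw [adExt_algebraMap, contr_algebraMap, contr_algebraMap, map_smul, map_zero,
      LinearMap.zero_apply, add_zero]
  | add a b ha hb => simp only [map_add, LinearMap.add_apply, ha, hb]; abel
  | ι_mul q y h =>
    rw [contr_mul_apply, contr_mul_apply, contr_ι, h, lieG_iotaG (hv x y), adExt_ι_mul, map_add,
      map_add, LinearMap.add_apply, contr_mul_apply, contr_mul_apply, contr_ι, contr_ι, add_assoc]

/-- The extended Cartan formula for a form preserved by the action. -/
theorem dG_contr (hv : ∀ (x y : 𝔤) (a : M),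
      v ⁅x, y⁆ a = VectorField.mlieBracket 𝓘(ℝ, E) (v x) (v y) a)
    {β : GForm E M} (hβ : ∀ x, lieG (v x) β = 0) (q : ExteriorAlgebra ℝ 𝔤) :
    dG (contr v q β) =
      contr v (parity 𝔤 q) (dG β) - contr v (parity 𝔤 (boundaryExt q)) β := by
  induction q using exteriorAlgebra_right_induction with
  | algebraMap r =>
    rw [boundaryExt_algebraMap, AlgHom.commutes, contr_algebraMap, contr_algebraMap, map_smul,
      map_zero, map_zero, LinearMap.zero_apply, sub_zero]
  | add a b ha hb => simp only [map_add, LinearMap.add_apply, ha, hb]; abel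
  | mul_ι x q h =>
    have h₁ : dG (iotaG E M (v x) (contr v q β)) =
        lieG (v x) (contr v q β) - iotaG E M (v x) (dG (contr v q β)) := by
      rw [lieG_apply, add_sub_cancel_right]
    rw [contr_mul_apply, contr_ι, h₁, lieG_contr hv, hβ, map_zero, zero_add, h, boundaryExt_mul_ι,
      map_mul (parity 𝔤), map_sub (parity 𝔤), map_mul (parity 𝔤), adExt_parity, parity_parity,
      parity_ι, mul_neg, mul_neg, map_neg, map_sub (contr v), map_neg,
      LinearMap.neg_apply, LinearMap.sub_apply, LinearMap.neg_apply, contr_mul_apply,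
      contr_mul_apply, contr_ι, map_sub]
    abel

theorem contractVectors_cons {V : Type*} [AddCommGroup V] [Module ℝ V] [TopologicalSpace V]
    {k j N : ℕ} (h : k + 1 + j = N + 1) (h' : k + j = N) (a : V [⋀^Fin (N + 1)]→L[ℝ] ℝ)
    (X : Fin (k + 1) → V) :
    contractVectors h a X = contractVectors h' (interior (X 0) a) (Fin.tail X) := by
  subst h'
  ext w
  change a _ = a _
  congr 1
  funext i
  refine Fin.cases ?_ (fun i => ?_) i
  · rfl
  · refine Fin.addCases (fun i => ?_) (fun i => ?_) i
    · have e : Fin.cast h.symm (Fin.castAdd j i).succ = Fin.castAdd j i.succ := Fin.ext rfl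
      change Fin.append X w _ = Fin.append (Fin.tail X) w (Fin.castAdd j i)
      rw [e, Fin.append_left, Fin.append_left, Fin.tail]
    · have e : Fin.cast h.symm (Fin.natAdd k i).succ = Fin.natAdd (k + 1) i :=
        Fin.ext (by simp; omega)
      change Fin.append X w _ = Fin.append (Fin.tail X) w (Fin.natAdd k i)
      rw [e, Fin.append_right, Fin.append_right]

theorem coe_contr_ιMulti (v : 𝔤 →ₗ[ℝ] VField E M) {i j N : ℕ} (h : i + j = N) (x : Fin i → 𝔤)
    (α : Form E M N) (a : M) :
    (contr v (ExteriorAlgebra.ιMulti ℝ i x) (homog E M N α) j : RawForm E M j) a =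
      contractVectors h ((α : RawForm E M N) a) fun l => v (x l) a := by
  induction i generalizing N with
  | zero =>
    obtain rfl : j = N := by omega
    rw [ExteriorAlgebra.ιMulti_zero_apply, contr_one, homog_self]
    ext w
    change _ = (α : RawForm E M j) a _
    congr 1
    funext l
    have e : Fin.cast h.symm l = Fin.natAdd 0 l := Fin.ext (by simp)
    rw [e, Fin.append_right]
  | succ i ih =>
    obtain ⟨N, rfl⟩ : ∃ N', N = N' + 1 := ⟨i + j, by omega⟩
    rw [ExteriorAlgebra.ιMulti_succ_apply, contr_mul_apply, contr_ι, iotaG_homog,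
      ih (by omega), contractVectors_cons h (by omega)]
    rfl

theorem coe_contr (v : 𝔤 →ₗ[ℝ] VField E M) {i j N : ℕ} (h : i + j = N) (p : ⋀[ℝ]^i 𝔤)
    (α : Form E M N) :
    (degPart j (contr v (p : ExteriorAlgebra ℝ 𝔤) (homog E M N α)) : RawForm E M j) =
      iotaP h v p (α : RawForm E M N) := by
  funext a
  let A : ⋀[ℝ]^i 𝔤 →ₗ[ℝ] (TangentSpace 𝓘(ℝ, E) a) [⋀^Fin j]→L[ℝ] ℝ :=
    LinearMap.proj a ∘ₗ (Form E M j).subtype ∘ₗ degPart j ∘ₗ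
      LinearMap.applyₗ (homog E M N α) ∘ₗ contr v ∘ₗ (⋀[ℝ]^i 𝔤).subtype
  let B : ⋀[ℝ]^i 𝔤 →ₗ[ℝ] (TangentSpace 𝓘(ℝ, E) a) [⋀^Fin j]→L[ℝ] ℝ :=
    exteriorPower.alternatingMapLinearEquiv (contractAlt h ((α : RawForm E M N) a)) ∘ₗ
      exteriorPower.map i (evalAt E a ∘ₗ v)
  have : A = B := by
    apply exteriorPower.linearMap_ext
    ext x : 1
    simp only [LinearMap.compAlternatingMap_apply, B, LinearMap.comp_apply,
      exteriorPower.map_apply_ιMulti, exteriorPower.alternatingMapLinearEquiv_apply_ιMulti]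
    exact coe_contr_ιMulti v h x α a
  exact LinearMap.congr_fun this p

end Action

end Contraction

theorem sgn_succ (k : ℕ) : sgn (k + 1) = (-1) ^ (k + 1) * sgn k := by
  have h : (k + 1) * (k + 1 + 1) / 2 = k * (k + 1) / 2 + (k + 1) := by
    rw [show (k + 1) * (k + 1 + 1) = k * (k + 1) + (k + 1) * 2 by ring,
      Nat.add_mul_div_right _ _ two_pos]
  rw [sgn, sgn, h, pow_add]
  ring

theorem sgn_succ_mul_neg_one_pow {k j m : ℕ} (h : k + j = m + 1) :
    sgn (k + 1) * (-1) ^ (m + j) = sgn k := by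
  have e : (-1 : ℝ) ^ (m + j) = (-1) ^ (k + 1) := by
    have h₁ : (-1 : ℝ) ^ (m + j) = (-1) ^ (m + j + 2) := by simp [pow_add]
    rw [h₁, show m + j + 2 = k + 1 + 2 * j by omega, pow_add, pow_mul]
    simp
  rw [e, sgn_succ, mul_right_comm, ← mul_pow]
  simp

theorem neg_add_eq_of_neg_eq {W : Type*} [AddCommGroup W] {a d s : W} (h : -a = d + s) (c b : W) :
    -(a + c) = d + b + (s - b - c) := by
  rw [neg_add, h]
  abel

theorem neg_add_eq_sub_of_neg_eq {W : Type*} [AddCommGroup W] {a s : W} (h : -a = s) (c : W) :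
    -(a + c) = s - 0 - c := by
  rw [neg_add, h]
  abel

theorem smul_map_sub_sub {W W' : Type*} [AddCommGroup W] [Module ℝ W] [AddCommGroup W']
    [Module ℝ W'] (r : ℝ) (L : W →ₗ[ℝ] W') (a b c : W) :
    r • L (a - b - c) = r • L a - r • L b - r • L c := by
  rw [map_sub, map_sub, smul_sub, smul_sub]

theorem sgn_one : sgn 1 = 1 := by simp [sgn]

section Main

open ExteriorAlgebra

variable {E : Type*} [NormedAddCommGroup E] [NormedSpace ℝ E] [CompleteSpace E]
  {M : Type*} [TopologicalSpace M] [ChartedSpace E M] [IsManifold 𝓘(ℝ, E) ∞ M]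

section Hamiltonian

variable {m : ℕ} {Ω : Form E M (m + 2)} {H : Form E M m} {X vH : VField E M}

theorem dG_homog_eq_neg_iotaG (hH : IsHamiltonianVF Ω H vH) :
    dG (homog E M m H) = -iotaG E M vH (homog E M (m + 2) Ω) := by
  rw [dG_homog, iotaG_homog, ← map_neg]
  exact congrArg _ (Subtype.ext hH)

theorem lieG_dG {β : GForm E M} (h : lieG X β = 0) : lieG X (dG β) = 0 := by
  rw [lieG_apply, dG_dG, map_zero, add_zero]
  have := congrArg dG h
  rwa [lieG_apply, map_add, dG_dG, zero_add, map_zero] at this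

/-- A vector field preserving `Ω` and `H` commutes with the Hamiltonian vector field of `H`. -/
theorem mlieBracket_hamiltonian_eq_zero (hΩ : IsPlectic Ω) (hH : IsHamiltonianVF Ω H vH)
    (hXΩ : lieD X (Ω : RawForm E M (m + 2)) = 0) (hXH : lieD X (H : RawForm E M m) = 0) (a : M) :
    VectorField.mlieBracket 𝓘(ℝ, E) X vH a = 0 := by
  have h₁ := lieG_dG (lieG_homog hXH)
  rw [dG_homog_eq_neg_iotaG hH, map_neg, neg_eq_zero, iotaG_homog] at h₁
  have h₂ := coe_lieG X (homog E M (m + 1) (iotaForm vH Ω)) (m + 1)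
  rw [h₁, homog_self] at h₂
  have h₃ := congrFun (h₂.trans (lieD_iota X vH Ω.2)) a
  rw [hXΩ] at h₃
  refine hΩ.nondegenerate a ?_
  have h₄ : (0 : (TangentSpace 𝓘(ℝ, E) a) [⋀^Fin (m + 1)]→L[ℝ] ℝ) = 0 + _ := h₃
  rw [zero_add] at h₄
  refine h₄.symm.trans ?_
  exact (map_zero (ContinuousAlternatingMap.curryLeft (formAt (Ω : RawForm E M (m + 2)) a))).symm

theorem lieG_add_smul (X Y : VField E M) (c : ℝ) (β : GForm E M) :
    lieG (X + c • Y) β = lieG X β + c • lieG Y β := by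
  simp only [lieG_apply, map_add, map_smul, LinearMap.add_apply, LinearMap.smul_apply, smul_add]
  abel

theorem lieG_hamiltonian (hΩ : IsPlectic Ω) (hH : IsHamiltonianVF Ω H vH) :
    lieG vH (homog E M (m + 2) Ω) = 0 := by
  have h : dG (homog E M (m + 2) Ω) = 0 := by
    rw [dG_homog, show dForm Ω = 0 from Subtype.ext hΩ.closed, map_zero]
  have h' := congrArg dG (dG_homog_eq_neg_iotaG hH)
  rw [dG_dG, map_neg, eq_comm, neg_eq_zero] at h'
  rw [lieG_apply, h, h', map_zero, add_zero]

theorem globallyConserved_of_iotaG_dG {β : GForm E M} (h : iotaG E M X (dG β) = 0) (j : ℕ) :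
    GloballyConserved X (β j : RawForm E M j) := by
  have h' : lieG X β = dG (iotaG E M X β) := by rw [lieG_apply, h, add_zero]
  rw [GloballyConserved, ← coe_lieG, h']
  cases j with
  | zero => rfl
  | succ j => exact ⟨_, (iotaG E M X β j).2, rfl⟩

end Hamiltonian

variable {𝔤 : Type*} [LieRing 𝔤] [LieAlgebra ℝ 𝔤]
  {m : ℕ} {Ω : Form E M (m + 2)} {v : 𝔤 →ₗ[ℝ] VField E M} {H : Form E M m} {vH : VField E M}

omit [CompleteSpace E] in
theorem extendAction_apply (v : 𝔤 →ₗ[ℝ] VField E M) (X : VField E M) (x : 𝔤 × ℝ) :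
    extendAction v X x = v x.1 + x.2 • X := by
  simp [extendAction]

omit [CompleteSpace E] in
theorem mdifferentiableAt_section (X : VField E M) (a : M) :
    MDifferentiableAt 𝓘(ℝ, E) 𝓘(ℝ, E).tangent
      (fun b => (⟨b, X b⟩ : TangentBundle 𝓘(ℝ, E) M)) a :=
  (X.contMDiff_toFun a).mdifferentiableAt (by simp)

theorem mlieBracket_add_smul {X Y Z : VField E M}
    (h₁ : ∀ a, VectorField.mlieBracket 𝓘(ℝ, E) X Z a = 0)
    (h₂ : ∀ a, VectorField.mlieBracket 𝓘(ℝ, E) Y Z a = 0) (s t : ℝ) (a : M) :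
    VectorField.mlieBracket 𝓘(ℝ, E) (X + s • Z : VField E M) (Y + t • Z : VField E M) a =
      VectorField.mlieBracket 𝓘(ℝ, E) X Y a := by
  have hX := mdifferentiableAt_section X a
  have hY := mdifferentiableAt_section Y a
  have hZ := mdifferentiableAt_section Z a
  have hsZ := mdifferentiableAt_section (s • Z) a
  have htZ := mdifferentiableAt_section (t • Z) a
  have hYZ := mdifferentiableAt_section (Y + t • Z) a
  rw [ContMDiffSection.coe_add, VectorField.mlieBracket_add_left hX hsZ, ContMDiffSection.coe_add,
    VectorField.mlieBracket_add_right hY htZ, VectorField.mlieBracket_add_right hY htZ,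
    ContMDiffSection.coe_smul, ContMDiffSection.coe_smul,
    VectorField.mlieBracket_const_smul_right hZ, VectorField.mlieBracket_const_smul_left hZ,
    VectorField.mlieBracket_const_smul_left hZ, VectorField.mlieBracket_const_smul_right hZ,
    h₁, VectorField.mlieBracket_swap_apply (V := Z) (W := Y), h₂, VectorField.mlieBracket_self]
  simp

/-- The extended action is multisymplectic. -/
theorem isMultisymplecticAction_extendAction (hΩ : IsPlectic Ω)
    (hv : IsMultisymplecticAction Ω v) (hH : IsHamiltonianVF Ω H vH)
    (hpres : StrictlyPreserves v H) :
    IsMultisymplecticAction (𝔤 := 𝔤 × ℝ) Ω (extendAction v vH) where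
  map_lie x y a := by
    have hc (z : 𝔤) (b : M) : VectorField.mlieBracket 𝓘(ℝ, E) (v z) vH b = 0 :=
      mlieBracket_hamiltonian_eq_zero hΩ hH (hv.preserves z) (hpres z) b
    rw [extendAction_apply, extendAction_apply, extendAction_apply,
      mlieBracket_add_smul (hc x.1) (hc y.1), ← hv.map_lie,
      show ⁅x, y⁆ = (⁅x.1, y.1⁆, (0 : ℝ)) from rfl, zero_smul, add_zero]
  preserves x := by
    have h := lieG_add_smul (v x.1) vH x.2 (homog E M (m + 2) Ω)
    rw [lieG_homog (hv.preserves x.1), lieG_hamiltonian hΩ hH, smul_zero, add_zero] at h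
    have h' := coe_lieG (v x.1 + x.2 • vH) (homog E M (m + 2) Ω) (m + 2)
    rw [h, homog_self] at h'
    rw [extendAction_apply]
    exact h'.symm

omit [CompleteSpace E] in
theorem extendAction_comp_inl (v : 𝔤 →ₗ[ℝ] VField E M) (X : VField E M) :
    extendAction v X ∘ₗ LinearMap.inl ℝ 𝔤 ℝ = v := by
  simp [extendAction]

theorem contr_extendAction (v : 𝔤 →ₗ[ℝ] VField E M) (X : VField E M)
    (q : ExteriorAlgebra ℝ (𝔤 × ℝ)) (β : GForm E M) :
    contr (extendAction v X) q β =
      contr v (fstExt 𝔤 q) β + contr v (parity 𝔤 (cPart 𝔤 q)) (iotaG E M X β) := by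
  conv_lhs => rw [← inlExt_add_inlExt_mul_ι q]
  rw [map_add, LinearMap.add_apply, contr_mul_apply, contr_ι, inlExt, contr_map, contr_map,
    extendAction_comp_inl, extendAction_apply, map_zero, zero_add, one_smul, iotaG_contr]

theorem contr_extendAction_hamiltonian (hv : IsMultisymplecticAction Ω v)
    (hH : IsHamiltonianVF Ω H vH) (hpres : StrictlyPreserves v H)
    (q : ExteriorAlgebra ℝ (𝔤 × ℝ)) :
    contr (extendAction v vH) q (homog E M (m + 2) Ω) =
      contr v (fstExt 𝔤 q) (homog E M (m + 2) Ω) - dG (contr v (cPart 𝔤 q) (homog E M m H)) -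
        contr v (parity 𝔤 (cPart 𝔤 (boundaryExt q))) (homog E M m H) := by
  rw [contr_extendAction, dG_contr hv.map_lie (fun x => lieG_homog (hpres x)),
    dG_homog_eq_neg_iotaG hH, cPart_boundaryExt, map_neg]
  abel

/-- The maps of the extended co-momentum map. -/
def extendF (f : CoMomentum Ω v) (H : Form E M m) (i j : ℕ) (h : i + j = m + 1) :
    ⋀[ℝ]^i (𝔤 × ℝ) →ₗ[ℝ] Form E M j :=
  f.f i j h ∘ₗ exteriorPower.map i (LinearMap.fst ℝ 𝔤 ℝ) +
    sgn i • (degPart j ∘ₗ LinearMap.applyₗ (homog E M m H) ∘ₗ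
      contr v ∘ₗ cPart 𝔤 ∘ₗ (⋀[ℝ]^i (𝔤 × ℝ)).subtype)

theorem extendF_apply (f : CoMomentum Ω v) {i j : ℕ} (h : i + j = m + 1)
    (P : ⋀[ℝ]^i (𝔤 × ℝ)) :
    extendF f H i j h P = f.f i j h (exteriorPower.map i (LinearMap.fst ℝ 𝔤 ℝ) P) +
      sgn i • degPart j (contr v (cPart 𝔤 (P : ExteriorAlgebra ℝ (𝔤 × ℝ))) (homog E M m H)) := rfl

theorem extendF_boundary (f : CoMomentum Ω v) {i j : ℕ} (h : i + j = m + 1)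
    (P : ⋀[ℝ]^(i + 1) (𝔤 × ℝ)) :
    extendF f H i j h (boundary i P) =
      f.f i j h (boundary i (exteriorPower.map (i + 1) (LinearMap.fst ℝ 𝔤 ℝ) P)) +
      sgn i • degPart j (contr v (cPart 𝔤 (boundaryExt (P : ExteriorAlgebra ℝ (𝔤 × ℝ))))
        (homog E M m H)) := by
  rw [extendF_apply, boundary_map fst_lie, coe_boundary]

theorem fstExt_coe {i : ℕ} (P : ⋀[ℝ]^i (𝔤 × ℝ)) :
    fstExt 𝔤 (P : ExteriorAlgebra ℝ (𝔤 × ℝ)) =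
      (exteriorPower.map i (LinearMap.fst ℝ 𝔤 ℝ) P : ⋀[ℝ]^i 𝔤) :=
  (coe_exteriorPower_map i _ P).symm

theorem sgn_smul_contr_extendAction (hv : IsMultisymplecticAction Ω v)
    (hH : IsHamiltonianVF Ω H vH) (hpres : StrictlyPreserves v H) {i j : ℕ} (h : i + j = m + 1)
    (P : ⋀[ℝ]^(i + 1) (𝔤 × ℝ)) :
    sgn (i + 1) • degPart j (contr (extendAction v vH) (P : ExteriorAlgebra ℝ (𝔤 × ℝ))
        (homog E M (m + 2) Ω)) =
      sgn (i + 1) •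
        degPart j (contr v (exteriorPower.map (i + 1) (LinearMap.fst ℝ 𝔤 ℝ) P : ⋀[ℝ]^(i + 1) 𝔤)
        (homog E M (m + 2) Ω)) -
      sgn (i + 1) •
        degPart j (dG (contr v (cPart 𝔤 (P : ExteriorAlgebra ℝ (𝔤 × ℝ))) (homog E M m H))) -
      sgn i • degPart j (contr v (cPart 𝔤 (boundaryExt (P : ExteriorAlgebra ℝ (𝔤 × ℝ))))
        (homog E M m H)) := by
  rw [← sgn_succ_mul_neg_one_pow h, mul_smul, ← contr_parity_homog, ← fstExt_coe,
    contr_extendAction_hamiltonian hv hH hpres]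
  exact smul_map_sub_sub (W := GForm E M) (W' := Form E M j) _ (degPart j) _ _ _

theorem extendF_main (f : CoMomentum Ω v) (hv : IsMultisymplecticAction Ω v)
    (hH : IsHamiltonianVF Ω H vH) (hpres : StrictlyPreserves v H)
    (i j : ℕ) (h : i + (j + 1) = m + 1) (P : ⋀[ℝ]^(i + 1) (𝔤 × ℝ)) :
    -(extendF f H i (j + 1) h (boundary i P) : RawForm E M (j + 1)) =
      extD (extendF f H (i + 1) j (by omega) P : RawForm E M j)
        + sgn (i + 1) • iotaP (by omega) (extendAction v vH) P (Ω : RawForm E M (m + 2)) := by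
  have hN : i + 1 + (j + 1) = m + 2 := by omega
  have hf := f.main i j h (exteriorPower.map (i + 1) (LinearMap.fst ℝ 𝔤 ℝ) P)
  rw [← coe_contr v hN] at hf
  rw [← coe_contr (extendAction v vH) hN]
  have hf' : -f.f i (j + 1) h (boundary i (exteriorPower.map (i + 1) (LinearMap.fst ℝ 𝔤 ℝ) P)) =
      dForm (f.f (i + 1) j (by omega) (exteriorPower.map (i + 1) (LinearMap.fst ℝ 𝔤 ℝ) P)) +
      sgn (i + 1) •
        degPart (j + 1) (contr v
          (exteriorPower.map (i + 1) (LinearMap.fst ℝ 𝔤 ℝ) P : ⋀[ℝ]^(i + 1) 𝔤) (homog E M (m + 2) Ω)) := Subtype.ext hf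
  suffices -extendF f H i (j + 1) h (boundary i P) =
      dForm (extendF f H (i + 1) j (by omega) P) +
      sgn (i + 1) •
        degPart (j + 1) (contr (extendAction v vH) (P : ExteriorAlgebra ℝ (𝔤 × ℝ))
        (homog E M (m + 2) Ω)) from congrArg Subtype.val this
  rw [sgn_smul_contr_extendAction hv hH hpres h, extendF_boundary, extendF_apply, map_add,
    map_smul, degPart_succ_dG]
  exact neg_add_eq_of_neg_eq (W := Form E M (j + 1)) hf' _ _

theorem extendF_main_top (f : CoMomentum Ω v) (hv : IsMultisymplecticAction Ω v)
    (hH : IsHamiltonianVF Ω H vH) (hpres : StrictlyPreserves v H) (P : ⋀[ℝ]^(m + 2) (𝔤 × ℝ)) :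
    -(extendF f H (m + 1) 0 rfl (boundary (m + 1) P) : RawForm E M 0) =
      sgn (m + 2) • iotaP rfl (extendAction v vH) P (Ω : RawForm E M (m + 2)) := by
  have hf := f.main_top (exteriorPower.map (m + 2) (LinearMap.fst ℝ 𝔤 ℝ) P)
  rw [← coe_contr v rfl] at hf
  rw [← coe_contr (extendAction v vH) rfl]
  have hf' : -f.f (m + 1) 0 rfl
      (boundary (m + 1) (exteriorPower.map (m + 2) (LinearMap.fst ℝ 𝔤 ℝ) P)) =
      sgn (m + 2) •
        degPart 0 (contr v (exteriorPower.map (m + 2) (LinearMap.fst ℝ 𝔤 ℝ) P : ⋀[ℝ]^(m + 2) 𝔤)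
        (homog E M (m + 2) Ω)) := Subtype.ext hf
  suffices -extendF f H (m + 1) 0 rfl (boundary (m + 1) P) =
      sgn (m + 2) • degPart 0 (contr (extendAction v vH) (P : ExteriorAlgebra ℝ (𝔤 × ℝ))
        (homog E M (m + 2) Ω)) from congrArg Subtype.val this
  rw [sgn_smul_contr_extendAction (i := m + 1) (j := 0) hv hH hpres rfl, extendF_boundary,
    degPart_zero_dG, smul_zero]
  exact neg_add_eq_sub_of_neg_eq (W := Form E M 0) hf' _

theorem extendF_zero (f : CoMomentum Ω v) : extendF f H 0 (m + 1) (Nat.zero_add _) = 0 := by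
  refine LinearMap.ext fun P => ?_
  have hP : cPart 𝔤 (P : ExteriorAlgebra ℝ (𝔤 × ℝ)) = 0 := by
    obtain ⟨P, hP'⟩ := P
    rw [exteriorPower, pow_zero, Submodule.mem_one] at hP'
    obtain ⟨r, rfl⟩ := hP'
    exact cPart_algebraMap r
  rw [extendF_apply, f.f_zero, hP, map_zero, LinearMap.zero_apply, LinearMap.zero_apply, map_zero,
    smul_zero, add_zero, LinearMap.zero_apply]

theorem extendF_momentum (f : CoMomentum Ω v) (hv : IsMultisymplecticAction Ω v)
    (hH : IsHamiltonianVF Ω H vH) (hpres : StrictlyPreserves v H) (x : 𝔤 × ℝ) :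
    IsHamiltonianVF Ω (extendF f H 1 m (Nat.add_comm 1 m) (exteriorPower.ιMulti ℝ 1 ![x]))
      (extendAction v vH x) := by
  have h := extendF_main f hv hH hpres 0 m (Nat.zero_add _) (exteriorPower.ιMulti ℝ 1 ![x])
  have hι : iotaP (k := 1) (j := m + 1) (by omega) (extendAction v vH)
      (exteriorPower.ιMulti ℝ 1 ![x]) (Ω : RawForm E M (m + 2)) =
        iota (extendAction v vH x) (Ω : RawForm E M (m + 2)) := by
    rw [← coe_contr, exteriorPower.ιMulti_apply_coe, ExteriorAlgebra.ιMulti_succ_apply,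
      ExteriorAlgebra.ιMulti_zero_apply, mul_one, contr_ι, iotaG_homog]
    exact congrArg Subtype.val (homog_self _)
  have h' : (0 : RawForm E M (m + 1)) =
      extD (extendF f H 1 m (Nat.add_comm 1 m) (exteriorPower.ιMulti ℝ 1 ![x]) : RawForm E M m) +
        iota (extendAction v vH x) (Ω : RawForm E M (m + 2)) := by
    rw [extendF_zero] at h
    refine (neg_zero.symm.trans h).trans (congrArg _ ?_)
    rw [← hι]
    exact (congrArg (· • _) sgn_one).trans (one_smul ℝ _)
  exact eq_neg_of_add_eq_zero_left h'.symm

theorem eq_ιMulti_one {V : Type*} [AddCommGroup V] [Module ℝ V] (p : ⋀[ℝ]^1 V) :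
    ∃ x : V, exteriorPower.ιMulti ℝ 1 ![x] = p :=
  ⟨exteriorPower.oneEquiv ℝ V p, (exteriorPower.oneEquiv ℝ V).injective
    (by rw [exteriorPower.oneEquiv_ιMulti]; rfl)⟩

/-- The extension of a co-momentum map by a preserved Hamiltonian form. -/
def extendCoMomentum (f : CoMomentum Ω v) (hv : IsMultisymplecticAction Ω v)
    (hH : IsHamiltonianVF Ω H vH) (hpres : StrictlyPreserves v H) :
    CoMomentum (𝔤 := 𝔤 × ℝ) Ω (extendAction v vH) where
  f := extendF f H
  f_zero := extendF_zero f
  hamiltonian p := by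
    obtain ⟨x, rfl⟩ := eq_ιMulti_one p
    exact ⟨_, extendF_momentum f hv hH hpres x⟩
  momentum := extendF_momentum f hv hH hpres
  main := extendF_main f hv hH hpres
  main_top := extendF_main_top f hv hH hpres

theorem extendF_tensorC (f : CoMomentum Ω v) {i j : ℕ} (h : i + j = m) (p : ⋀[ℝ]^i 𝔤) :
    extendF f H (i + 1) j (by omega) (tensorC p) =
      sgn (i + 1) • degPart j (contr v (p : ExteriorAlgebra ℝ 𝔤) (homog E M m H)) := by
  have h₀ : exteriorPower.map (i + 1) (LinearMap.fst ℝ 𝔤 ℝ) (tensorC p) = 0 := by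
    apply Subtype.ext
    rw [← fstExt_coe, coe_tensorC, map_mul, fstExt_ι, map_zero, mul_zero]
    rfl
  rw [extendF_apply, h₀, map_zero, zero_add, coe_tensorC, cPart_inlExt_mul_ι]

theorem extendF_map_inl (f : CoMomentum Ω v) {i j : ℕ} (h : i + j = m + 1) (p : ⋀[ℝ]^i 𝔤) :
    extendF f H i j h (exteriorPower.map i (LinearMap.inl ℝ 𝔤 ℝ) p) = f.f i j h p := by
  have h₀ : cPart 𝔤 (exteriorPower.map i (LinearMap.inl ℝ 𝔤 ℝ) p :
      ExteriorAlgebra ℝ (𝔤 × ℝ)) = 0 := by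
    rw [coe_exteriorPower_map]
    exact cPart_inlExt _
  have h₁ : exteriorPower.map i (LinearMap.fst ℝ 𝔤 ℝ)
      (exteriorPower.map i (LinearMap.inl ℝ 𝔤 ℝ) p) = p := by
    apply Subtype.ext
    rw [coe_exteriorPower_map, coe_exteriorPower_map]
    exact fstExt_inlExt _
  rw [extendF_apply, h₀, h₁, map_zero, LinearMap.zero_apply, map_zero, smul_zero, add_zero]

theorem isExtension_extendCoMomentum (f : CoMomentum Ω v) (hv : IsMultisymplecticAction Ω v)
    (hH : IsHamiltonianVF Ω H vH) (hpres : StrictlyPreserves v H) :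
    IsExtension f H (extendCoMomentum f hv hH hpres) where
  restrict _ _ h p := extendF_map_inl f h p
  apply_tensorC i j h p := by
    rw [← coe_contr v h]
    exact congrArg Subtype.val (extendF_tensorC f h p)

omit [CompleteSpace E] in
theorem IsExtension.unique {f : CoMomentum Ω v}
    {F F' : CoMomentum (𝔤 := 𝔤 × ℝ) Ω (extendAction v vH)}
    (hF : IsExtension f H F) (hF' : IsExtension f H F') : F' = F := by
  ext1
  funext i j h
  cases i with
  | zero =>
    obtain rfl : j = m + 1 := by omega
    exact F'.f_zero.trans F.f_zero.symm
  | succ i =>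
    refine LinearMap.ext fun P => ?_
    obtain ⟨p₀, p₁, rfl⟩ := exists_map_inl_add_tensorC i P
    have h₁ : F'.f (i + 1) j h (tensorC p₁) = F.f (i + 1) j h (tensorC p₁) :=
      Subtype.ext ((hF'.apply_tensorC i j (by omega) p₁).trans
        (hF.apply_tensorC i j (by omega) p₁).symm)
    rw [map_add, map_add, hF.restrict, hF'.restrict, h₁]

theorem iotaG_dG_contr_of_boundaryExt_eq_zero (hv : IsMultisymplecticAction Ω v)
    (hH : IsHamiltonianVF Ω H vH) (hpres : StrictlyPreserves v H) {q : ExteriorAlgebra ℝ 𝔤}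
    (hq : boundaryExt q = 0) : iotaG E M vH (dG (contr v q (homog E M m H))) = 0 := by
  rw [dG_contr hv.map_lie (fun x => lieG_homog (hpres x)), hq, map_zero, map_zero,
    LinearMap.zero_apply, sub_zero, dG_homog_eq_neg_iotaG hH, map_neg, map_neg, iotaG_contr,
    iotaG_iotaG_self, map_zero, neg_zero]

theorem globallyConserved_extendF_tensorC (f : CoMomentum Ω v) (hv : IsMultisymplecticAction Ω v)
    (hH : IsHamiltonianVF Ω H vH) (hpres : StrictlyPreserves v H) {i j : ℕ} (h : i + j = m)
    {p : ⋀[ℝ]^i 𝔤} (hp : p ∈ cycles 𝔤 i) :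
    GloballyConserved vH
      (extendF f H (i + 1) j (by omega) (tensorC p) : RawForm E M j) := by
  rw [extendF_tensorC f h]
  refine globallyConserved_of_iotaG_dG
    (β := sgn (i + 1) • contr v (p : ExteriorAlgebra ℝ 𝔤) (homog E M m H)) ?_ j
  rw [map_smul, map_smul, iotaG_dG_contr_of_boundaryExt_eq_zero hv hH hpres
    (boundaryExt_eq_zero_of_mem_cycles hp), smul_zero]

end Main

end Multisymplectic

end

/-- Here `n = m + 1 ≥ 1`, so `Ω` has degree `n + 1 = m + 2` and `H` has degree `n - 1 = m`;
in the last clause `k = i + 1`. -/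
theorem mainTheorem9
    {E : Type*} [NormedAddCommGroup E] [NormedSpace ℝ E] [FiniteDimensional ℝ E]
    {M : Type*} [TopologicalSpace M] [T2Space M] [SecondCountableTopology M]
    [ChartedSpace E M] [IsManifold 𝓘(ℝ, E) ∞ M]
    {𝔤 : Type*} [LieRing 𝔤] [LieAlgebra ℝ 𝔤]
    (m : ℕ) (Ω : Multisymplectic.Form E M (m + 2)) (hΩ : Multisymplectic.IsPlectic Ω)
    (v : 𝔤 →ₗ[ℝ] Multisymplectic.VField E M)
    (hv : Multisymplectic.IsMultisymplecticAction Ω v)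
    (f : Multisymplectic.CoMomentum Ω v)
    (H : Multisymplectic.Form E M m) (vH : Multisymplectic.VField E M)
    (hH : Multisymplectic.IsHamiltonianVF Ω H vH)
    (hpres : Multisymplectic.StrictlyPreserves v H) :
    Multisymplectic.IsMultisymplecticAction (𝔤 := 𝔤 × ℝ) Ω (Multisymplectic.extendAction v vH) ∧
    ∃ F : Multisymplectic.CoMomentum (𝔤 := 𝔤 × ℝ) Ω (Multisymplectic.extendAction v vH),
      Multisymplectic.IsExtension f H F ∧
      (∀ F' : Multisymplectic.CoMomentum (𝔤 := 𝔤 × ℝ) Ω (Multisymplectic.extendAction v vH),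
        Multisymplectic.IsExtension f H F' → F' = F) ∧
      ∀ (i j : ℕ) (h : i + j = m), ∀ p ∈ Multisymplectic.cycles 𝔤 i,
        Multisymplectic.GloballyConserved vH
          (F.f (i + 1) j (by omega) (Multisymplectic.tensorC p) :
            Multisymplectic.RawForm E M j) := by
  have : CompleteSpace E := FiniteDimensional.complete ℝ E
  exact ⟨Multisymplectic.isMultisymplecticAction_extendAction hΩ hv hH hpres,
    Multisymplectic.extendCoMomentum f hv hH hpres,
    Multisymplectic.isExtension_extendCoMomentum f hv hH hpres,
    fun _ hF' => (Multisymplectic.isExtension_extendCoMomentum f hv hH hpres).unique hF',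
    fun _ _ h _ hp => Multisymplectic.globallyConserved_extendF_tensorC f hv hH hpres h hp⟩
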